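/- Let $\mathcal H$ be a complex Hilbert space, let $\mathfrak F_+(\mathcal H)=\bigoplus_{n\ge 0} \mathcal H^{\otimes_s n}$ be its bosonic Fock space (the Hilbert direct sum of the symmetric Hilbert tensor powers), and let $a(\varphi)$, $a^*(\varphi)$ $(\varphi\in\mathcal H)$ be the annihilation and creation operators on the dense subspace of vectors with finitely many particles, with $[a(\varphi),a^*(\varphi')]=\langle\varphi,\varphi'\rangle\mathbf 1$. For every $\varphi\in\mathcal H$ the closure $\overline{a(\varphi)-a^*(\varphi)}$ is the generator of a unique strongly continuous one-parameter unitary group $t\mapsto e^{t\,\overline{a(\varphi)-a^*(\varphi)}}$, so that the unitary Weyl operator $W[\varphi]=e^{\overline{a(\varphi)-a^*(\varphi)}}$ is well defined. Let $\psi\in\mathcal H$ with $\|\psi\|=1$, and let $A=\frac i2\left(a(\psi)^2-a^*(\psi)^2\right)$ on the vectors with finitely many particles. Then: (1) $A$ is essentially self-adjoint. (2) For every Hilbert basis of $\mathcal H$ that contains $\psi$, let $F\subset\mathfrak F_+(\mathcal H)$ be the space of finite linear combinations of the vectors of the associated Hilbert basis of $\mathfrak F_+(\mathcal H)$ (the symmetrized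 tensor products of basis vectors). Then $A|_F$ is essentially self-adjoint with the same closure $\overline A$, and every $\Phi\in F$ is an analytic vector of $A|_F$: $A^n\Phi\in F$ for all $n$, and $\sum_{n\ge 0}\frac{|\lambda|^n}{n!}\|A^n\Phi\|<\infty$ for all $|\lambda|<\frac12$. (3) The strongly continuous one-parameter unitary group $E_\lambda=e^{i\lambda\overline A}$, $\lambda\in\mathbb R$, satisfies $E_\lambda W[\psi]E_\lambda^*=W[e^\lambda\psi]$ for all $\lambda\in\mathbb R$. -/

import Mathlib

open scoped TensorProduct

namespace BoseFock

noncomputable section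

universe u

/-! ### Unitary groups, their generators, and exponentials of unbounded operators -/

/-- A strongly continuous one-parameter group of unitary operators on `F`. -/
@[ext]
structure UnitaryGroup (F : Type u) [NormedAddCommGroup F] [InnerProductSpace ℂ F]
    [CompleteSpace F] where
  /-- the unitary operators of the group -/
  toFun : ℝ → unitary (F →L[ℂ] F)
  map_zero : toFun 0 = 1
  map_add : ∀ s t : ℝ, toFun (s + t) = toFun s * toFun t
  strongly_continuous : ∀ x : F, Continuous fun t : ℝ => (toFun t : F →L[ℂ] F) x

section Operators

variable {F : Type u} [NormedAddCommGroup F] [InnerProductSpace ℂ F] [CompleteSpace F]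

/-- `B` is the infinitesimal generator of `U`, i.e. `U t = exp (t B)`: the domain of `B` is the set
of all `x` for which the derivative of `t ↦ U t x` at `0` exists, and `B x` is that derivative. -/
def IsGenerator (U : UnitaryGroup F) (B : F →ₗ.[ℂ] F) : Prop :=
  ∀ x y : F, (x, y) ∈ B.graph ↔ HasDerivAt (fun t : ℝ => (U.toFun t : F →L[ℂ] F) x) y 0

open Classical in
/-- The unitary operator `exp B`, for `B` the generator of a strongly continuous one-parameter
unitary group (that is, for `B` skew-adjoint): the value of that group at time `1`.
The default value `0` is taken for other `B`. -/
def unitaryExp (B : F →ₗ.[ℂ] F) : F →L[ℂ] F :=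
  if h : ∃ U : UnitaryGroup F, IsGenerator U B then (h.choose.toFun 1 : F →L[ℂ] F) else 0

/-- `A` is densely defined and symmetric, and its closure is self-adjoint. -/
def IsEssentiallySelfAdjoint (A : F →ₗ.[ℂ] F) : Prop :=
  Dense (A.domain : Set F) ∧ A.IsFormalAdjoint A ∧ A.IsClosable ∧ IsSelfAdjoint A.closure

/-- `x` belongs to the domain of every power of `A`, and `∑ |t|ⁿ ‖Aⁿ x‖ / n! < ∞` whenever
`|t| < r`. The sequence `v` is `n ↦ Aⁿ x`. -/
def IsAnalyticVector (A : F →ₗ.[ℂ] F) (r : ℝ) (x : F) : Prop :=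
  ∃ v : ℕ → A.domain, (v 0 : F) = x ∧ (∀ n, (v (n + 1) : F) = A (v n)) ∧
    ∀ t : ℝ, |t| < r → Summable fun n : ℕ => |t| ^ n / (n.factorial : ℝ) * ‖(v n : F)‖

end Operators

/-! ### Hilbert tensor powers -/

/-- A bundled complex Hilbert space (used only to define the tensor powers by recursion). -/
structure HilbertSp : Type (u + 1) where
  /-- the underlying type -/
  carrier : Type u
  [normed : NormedAddCommGroup carrier]
  [inner : InnerProductSpace ℂ carrier]
  [complete : CompleteSpace carrier]

attribute [instance] HilbertSp.normed HilbertSp.inner HilbertSp.complete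

/-- The Hilbert tensor powers: the zeroth one is a copy of `ℂ` (as `ℂ^{pt}`, in the universe of
`H`), and the `(n+1)`-st one is the completion of the algebraic tensor product of `H` with the
`n`-th one. -/
def tower (H : Type u) [NormedAddCommGroup H] [InnerProductSpace ℂ H] : ℕ → HilbertSp.{u}
  | 0 => ⟨EuclideanSpace ℂ PUnit.{u + 1}⟩
  | n + 1 => ⟨UniformSpace.Completion (H ⊗[ℂ] (tower H n).carrier)⟩

/-- The `n`-fold Hilbert tensor product of `H` with itself. -/
abbrev TPow (H : Type u) [NormedAddCommGroup H] [InnerProductSpace ℂ H] (n : ℕ) : Type u :=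
  (tower H n).carrier

variable {H : Type u} [NormedAddCommGroup H] [InnerProductSpace ℂ H]

/-- The bounded operator `Φ ↦ f ⊗ Φ` from the `n`-th to the `(n+1)`-st tensor power. -/
def tensorLeft (n : ℕ) (f : H) : TPow H n →L[ℂ] TPow H (n + 1) :=
  (UniformSpace.Completion.toComplL (𝕜 := ℂ) (E := H ⊗[ℂ] TPow H n)).comp
    (TensorProduct.mkL ℂ H (TPow H n) f)

/-- The elementary tensor `f 0 ⊗ ⋯ ⊗ f (n-1)`; the empty one is the unit `1` of `ℂ`. -/
def tprod : (n : ℕ) → (Fin n → H) → TPow H n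
  | 0, _ => (EuclideanSpace.single PUnit.unit 1 : EuclideanSpace ℂ PUnit.{u + 1})
  | n + 1, f => tensorLeft n (f 0) (tprod n (Fin.tail f))

/-- The symmetrized elementary tensor `∑_σ f (σ 0) ⊗ ⋯ ⊗ f (σ (n-1))` (without normalization). -/
def symTensor (n : ℕ) (f : Fin n → H) : TPow H n :=
  ∑ σ : Equiv.Perm (Fin n), tprod n (fun i => f (σ i))

variable (H) in
/-- The symmetric `n`-fold Hilbert tensor power (the `n`-particle space): the closed linear span of
the symmetrized elementary tensors. -/
def symPow (n : ℕ) : Submodule ℂ (TPow H n) :=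
  (Submodule.span ℂ (Set.range (symTensor (H := H) n))).topologicalClosure

instance (n : ℕ) : CompleteSpace (symPow H n) :=
  (Submodule.isClosed_topologicalClosure _).completeSpace_coe

/-- The symmetrized elementary tensor, as an element of the `n`-particle space. -/
def symVec (n : ℕ) (f : Fin n → H) : symPow H n :=
  ⟨symTensor n f, Submodule.le_topologicalClosure _ (Submodule.subset_span ⟨f, rfl⟩)⟩

/-! ### The bosonic Fock space -/

variable (H) in
/-- The bosonic Fock space: the Hilbert direct sum of all `n`-particle spaces. -/
abbrev Fock : Type u := lp (fun n : ℕ => symPow H n) 2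

/-- A sequence of `n`-particle vectors of which only finitely many are nonzero, as an element of the
Fock space. -/
def ofFinite (Φ : (n : ℕ) → symPow H n) (h : ∃ N : ℕ, ∀ n, N ≤ n → Φ n = 0) : Fock H :=
  ⟨Φ, by
    obtain ⟨N, hN⟩ := h
    refine (memℓp_zero ((Set.finite_lt_nat N).subset fun n hn => ?_)).of_exponent_ge zero_le
    by_contra hlt
    exact hn (hN n (not_lt.mp hlt))⟩

variable (H) in
/-- The dense subspace of vectors with a finite number of particles. -/
def finiteParticle : Submodule ℂ (Fock H) where
  carrier := {Φ | ∃ N : ℕ, ∀ n, N ≤ n → Φ n = 0}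
  zero_mem' := ⟨0, fun _ _ => rfl⟩
  add_mem' := by
    rintro Φ Ψ ⟨N, hN⟩ ⟨M, hM⟩
    refine ⟨max N M, fun n hn => ?_⟩
    simp [hN n (le_trans (le_max_left _ _) hn), hM n (le_trans (le_max_right _ _) hn)]
  smul_mem' := by
    rintro c Φ ⟨N, hN⟩
    exact ⟨N, fun n hn => by simp [hN n hn]⟩

/-! ### Creation and annihilation operators -/

/-- The creation operator from the `n`-particle to the `(n+1)`-particle space,
`Φ ↦ √(n+1) P (f ⊗ Φ)`, where `P` is the orthogonal projection onto symmetric tensors. -/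
def createN (n : ℕ) (f : H) : symPow H n →L[ℂ] symPow H (n + 1) :=
  ((Real.sqrt (n + 1) : ℝ) : ℂ) •
    ((symPow H (n + 1)).orthogonalProjectionOnto.comp
      ((tensorLeft n f).comp (symPow H n).subtypeL))

/-- The annihilation operator from the `(n+1)`-particle to the `n`-particle space: the adjoint of
the creation operator. -/
def annihN (n : ℕ) (f : H) : symPow H (n + 1) →L[ℂ] symPow H n :=
  ContinuousLinearMap.adjoint (createN n f)

/-- The components of the vector `a*(f) Φ`. -/
def createSeq (f : H) (Φ : (n : ℕ) → symPow H n) : (n : ℕ) → symPow H n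
  | 0 => 0
  | n + 1 => createN n f (Φ n)

/-- The creation operator `a*(f)` on the finite particle vectors. -/
def create (f : H) : finiteParticle H →ₗ[ℂ] finiteParticle H where
  toFun Φ :=
    have h : ∃ N : ℕ, ∀ n, N ≤ n → createSeq f (Φ : Fock H) n = 0 := by
      obtain ⟨N, hN⟩ := Φ.2
      refine ⟨N + 1, fun n hn => ?_⟩
      cases n with
      | zero => rfl
      | succ m => simp [createSeq, hN m (by omega)]
    ⟨ofFinite (createSeq f (Φ : Fock H)) h, h⟩
  map_add' Φ Ψ := by
    apply Subtype.ext
    apply lp.ext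
    funext n
    cases n with
    | zero => exact (add_zero (0 : symPow H 0)).symm
    | succ m => exact map_add (createN m f) _ _
  map_smul' c Φ := by
    apply Subtype.ext
    apply lp.ext
    funext n
    cases n <;> simp [ofFinite, createSeq]

/-- The annihilation operator `a(f)` on the finite particle vectors. -/
def annih (f : H) : finiteParticle H →ₗ[ℂ] finiteParticle H where
  toFun Φ :=
    have h : ∃ N : ℕ, ∀ n, N ≤ n → annihN n f ((Φ : Fock H) (n + 1)) = 0 := by
      obtain ⟨N, hN⟩ := Φ.2
      exact ⟨N, fun n hn => by rw [hN (n + 1) (by omega), map_zero]⟩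
    ⟨ofFinite (fun n => annihN n f ((Φ : Fock H) (n + 1))) h, h⟩
  map_add' Φ Ψ := by
    apply Subtype.ext
    apply lp.ext
    funext n
    exact map_add (annihN n f) _ _
  map_smul' c Φ := by
    apply Subtype.ext
    apply lp.ext
    funext n
    simp [ofFinite]

/-- A linear map on the finite particle vectors, as an unbounded operator in the Fock space. -/
def toOp (T : finiteParticle H →ₗ[ℂ] finiteParticle H) : Fock H →ₗ.[ℂ] Fock H :=
  ⟨finiteParticle H, (finiteParticle H).subtype.comp T⟩

/-- The operator `a(f) - a*(f)` on the finite particle vectors. -/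
def fieldOp (f : H) : Fock H →ₗ.[ℂ] Fock H :=
  toOp (annih f - create f)

/-- The Weyl operator `W[f]`, the exponential of the closure of `a(f) - a*(f)`. -/
def weyl (f : H) : Fock H →L[ℂ] Fock H :=
  unitaryExp (fieldOp f).closure

/-- The squeeze operator `(i/2) (a(f)² - a*(f)²)` on the finite particle vectors. -/
def squeeze (f : H) : Fock H →ₗ.[ℂ] Fock H :=
  toOp ((Complex.I / 2) • (annih f ∘ₗ annih f - create f ∘ₗ create f))

/-- The finite linear combinations of the symmetrized elementary tensors of vectors from `w`. If `w`
is a Hilbert basis of `H`, these are the finite linear combinations of the vectors of the associated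
Hilbert basis of the Fock space. -/
def basisSpan (w : Set H) : Submodule ℂ (Fock H) :=
  Submodule.span ℂ {Φ | ∃ (n : ℕ) (f : Fin n → H), (∀ i, f i ∈ w) ∧ Φ = lp.single 2 n (symVec n f)}

end

end BoseFock

/-!
The proof rests on Nelson's analytic vector theorem, in the special case of an operator `B` that
maps a dense subspace `D` into itself, is skew-symmetric on it, and has `∑ |t|ⁿ / n! ‖Bⁿ x‖ < ∞` for
all `x ∈ D` and all `|t| < r`, with one radius `r` for the whole of `D` (`IsAnalyticSkew`).

*The group.* For `|s|, |t| < r` put `S t x = ∑ tⁿ / n! Bⁿ x`. By skew-symmetry and the binomial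
theorem, the Cauchy product of the two series gives `⟪S s x, S t y⟫ = ∑ (t - s)ᴺ / N! ⟪x, Bᴺ y⟫`
(`inner_expSum`). This one identity says that `S t` is isometric, that the adjoint of its extension
to the whole space is the extension of `S (-t)`, and that the extensions satisfy the group law as
long as all times are less than `r`. The powers of `S (t / k)` then define a unitary group for all
times (`group`).

*The closure.* If `w` is orthogonal to the range of `B ± 1`, then `⟪w, exp (t B) w⟫ = exp (∓ t)
‖w‖²`, which for a suitable sign of `t` contradicts the Cauchy-Schwarz inequality unless `w = 0`.
Hence the closure of `B ± 1` is onto, so the closure of `B` is skew-adjoint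
(`mem_closedGraph_of_forall`). As a consequence it has no proper skew-symmetric extension, and so it
is the generator of every unitary group that has the derivative `B` on `D`
(`isGenerator_of_hasDerivAt`), and it agrees with the closure of each restriction of `B` that
satisfies the same assumptions (`closure_eq_of_restrict`).

*Fock space.* On vectors with fewer than `N` particles, `a(f)` and `a*(f)` have norm at most `√N
‖f‖`. So with `P = a(f) - a*(f)` and `B = i A = (a*(ψ)² - a(ψ)²) / 2`, the vectors with finitely
many particles are analytic for `P`, and analytic with radius `1/2` for `B` (`isAnalyticSkew_field`,
`isAnalyticSkew_squeeze`). The span of a Fock basis is invariant under `a(ψ)` and `a*(ψ)`, by the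
formulas `createN_symVec` and `annihN_symVec`, and it is dense. The same formulas give the canonical
commutation relations, and hence `[B, P] = P` for `f = ψ`.

*Weyl operators.* From `P Bⁿ = (B - 1)ⁿ P` it follows that `P exp (t B) = exp (-t) exp (t B) P` on
`D` for `|t| < 1/2`, and hence that `(x, y) ↦ (exp (t B) x, exp (-t) exp (t B) y)` maps the closed
graph of `P` into itself. The group law extends this to all `t` (`group_mem_closedGraph`). So the
conjugate of the group of `P` by `exp (l B)` has the derivative `exp l P` on `D`, and it is
therefore the group generated by the closure of the field operator of `exp l ψ`.
-/

namespace BoseFock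

noncomputable section

universe u

open Filter Topology
open Finset.HasAntidiagonal (antidiagonal mem_antidiagonal sigmaAntidiagonalEquivProd)

local notation "⟪" x ", " y "⟫" => inner ℂ x y

/-! ### Cauchy products -/

/-- The Cauchy product of two absolutely convergent series, with respect to a bounded bilinear
map. -/
theorem hasSum_antidiagonal_of_bilinear {E G K : Type*} [NormedAddCommGroup E] [NormedSpace ℝ E]
    [NormedAddCommGroup G] [NormedSpace ℝ G] [NormedAddCommGroup K] [NormedSpace ℝ K]
    [CompleteSpace K] {f : E × G → K} (hf : IsBoundedBilinearMap ℝ f)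
    {a : ℕ → E} {b : ℕ → G} {A : E} {B : G} (ha : HasSum a A) (hb : HasSum b B)
    (ha' : Summable fun n => ‖a n‖) (hb' : Summable fun n => ‖b n‖) :
    HasSum (fun N => ∑ p ∈ antidiagonal N, f (a p.1, b p.2)) (f (A, B)) := by
  obtain ⟨C, -, hC⟩ := hf.bound
  have hs : Summable fun p : ℕ × ℕ => f (a p.1, b p.2) := by
    refine Summable.of_norm_bounded (g := fun p : ℕ × ℕ => C * (‖a p.1‖ * ‖b p.2‖)) ?_ ?_
    · exact (ha'.mul_of_nonneg hb' (fun _ => norm_nonneg _) (fun _ => norm_nonneg _)).mul_left C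
    · intro p
      rw [← mul_assoc]
      exact hC _ _
  have h1 : ∀ m, HasSum (fun n => f (a m, b n)) (f (a m, B)) := fun m =>
    (hf.toContinuousLinearMap (a m)).hasSum hb
  have h2 : HasSum (fun m => f (a m, B)) (f (A, B)) :=
    (hf.toContinuousLinearMap.flip B).hasSum ha
  have h3 : HasSum (fun p : ℕ × ℕ => f (a p.1, b p.2)) (f (A, B)) := by
    have := hs.hasSum.prod_fiberwise (fun m => h1 m)
    rw [h2.unique this]
    exact hs.hasSum
  have h4 := (sigmaAntidiagonalEquivProd (A := ℕ)).hasSum_iff.mpr h3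
  refine h4.sigma fun N => ?_
  have := hasSum_fintype fun p : antidiagonal N => f (a p.1.1, b p.1.2)
  rwa [Finset.sum_coe_sort (antidiagonal N) (fun p : ℕ × ℕ => f (a p.1, b p.2))] at this

theorem choose_div_factorial (i j : ℕ) : ((i + j).choose i : ℂ) / ((i + j).factorial : ℂ) =
    (i.factorial : ℂ)⁻¹ * (j.factorial : ℂ)⁻¹ := by
  have h := Nat.add_choose_mul_factorial_mul_factorial i j
  rw [← Nat.choose_symm_add] at h
  have h1 : (i.factorial : ℂ) ≠ 0 := by exact_mod_cast i.factorial_ne_zero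
  have h2 : (j.factorial : ℂ) ≠ 0 := by exact_mod_cast j.factorial_ne_zero
  have h3 : ((i + j).factorial : ℂ) ≠ 0 := by exact_mod_cast (i + j).factorial_ne_zero
  rw [div_eq_iff h3, ← h]
  push_cast
  field_simp

theorem sum_antidiagonal_pow_div_factorial (a b : ℂ) (N : ℕ) :
    ∑ p ∈ antidiagonal N, a ^ p.1 / (p.1.factorial : ℂ) * (b ^ p.2 / (p.2.factorial : ℂ)) =
      (a + b) ^ N / (N.factorial : ℂ) := by
  rw [(Commute.all a b).add_pow', Finset.sum_div]
  refine Finset.sum_congr rfl fun p hp => ?_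
  obtain rfl := (mem_antidiagonal.mp hp).symm
  rw [nsmul_eq_mul, mul_div_right_comm, choose_div_factorial]
  ring

section Abstract

variable {F : Type u} [NormedAddCommGroup F] [InnerProductSpace ℂ F]
variable {D : Submodule ℂ F} {B : D →ₗ[ℂ] D} {r : ℝ}

/-! ### Operators on an invariant domain and their closed graphs -/

/-- A linear map `B` of a subspace `D` into itself, as an unbounded operator with domain `D`. -/
def toPMap (B : D →ₗ[ℂ] D) : F →ₗ.[ℂ] F :=
  ⟨D, D.subtype.comp B⟩

theorem mem_graph_toPMap {p : F × F} :
    p ∈ (toPMap B).graph ↔ ∃ x : D, (x : F) = p.1 ∧ (B x : F) = p.2 :=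
  LinearPMap.mem_graph_iff _

/-- The closure of the graph of `B`. It makes sense whether or not `B` is closable. -/
def closedGraph (B : D →ₗ[ℂ] D) : Submodule ℂ (F × F) :=
  (toPMap B).graph.topologicalClosure

theorem mem_closedGraph (x : D) :
    ((x : F), (B x : F)) ∈ closedGraph B :=
  Submodule.le_topologicalClosure _ (mem_graph_toPMap.mpr ⟨x, rfl, rfl⟩)

theorem closedGraph_induction {P : F × F → Prop} (hP : IsClosed {p | P p})
    (h : ∀ x : D, P ((x : F), (B x : F)))
    {p : F × F} (hp : p ∈ closedGraph B) : P p := by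
  have : closure ((toPMap B).graph : Set (F × F)) ⊆ {p | P p} := by
    refine closure_minimal ?_ hP
    rintro ⟨x, y⟩ hxy
    obtain ⟨z, rfl, rfl⟩ := mem_graph_toPMap.mp hxy
    exact h z
  exact this hp

theorem mem_closedGraph_smul_iff (A : D →ₗ[ℂ] D) {c : ℂ} (hc : c ≠ 0)
    {x y : F} : (x, c • y) ∈ closedGraph (c • A) ↔ (x, y) ∈ closedGraph A := by
  have aux : ∀ (A : D →ₗ[ℂ] D) (c : ℂ) (x y : F), (x, y) ∈ closedGraph A →
      (x, c • y) ∈ closedGraph (c • A) := by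
    intro A c x y h
    refine closedGraph_induction (P := fun p : F × F => (p.1, c • p.2) ∈ closedGraph (c • A))
      ?_ (fun x => mem_closedGraph (B := c • A) x) h
    exact (Submodule.isClosed_topologicalClosure (toPMap (c • A)).graph).preimage
      (f := fun p : F × F => (p.1, c • p.2)) (by fun_prop)
  refine ⟨fun h => ?_, aux A c x y⟩
  have := aux _ c⁻¹ _ _ h
  rwa [smul_smul, smul_smul, inv_mul_cancel₀ hc, one_smul, one_smul] at this

/-- If the closure of the graph of an operator is the graph of a function, then it is the graph of
the closure of the operator. -/
theorem isClosable_and_graph_closure {A : D →ₗ[ℂ] D}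
    (h : ∀ y : F, ((0 : F), y) ∈ closedGraph A → y = 0) :
    (toPMap A).IsClosable ∧ (toPMap A).closure.graph = closedGraph A := by
  have h1 : (toPMap A).IsClosable := ⟨(closedGraph A).toLinearPMap, by
    rw [Submodule.toLinearPMap_graph_eq]
    · rfl
    · rintro ⟨x, y⟩ hp (rfl : x = 0)
      exact h y hp⟩
  exact ⟨h1, h1.graph_closure_eq_closure_graph.symm⟩

/-! ### Skew-symmetric operators with analytic vectors -/

/-- `B` is a skew-symmetric operator that maps a dense subspace `D` into itself, and all vectors of
`D` are analytic for `B`, with radius `r`. -/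
structure IsAnalyticSkew (D : Submodule ℂ F) (B : D →ₗ[ℂ] D) (r : ℝ) : Prop where
  dense : Dense (D : Set F)
  skew : ∀ x y : D, ⟪(B x : F), (y : F)⟫ = -⟪(x : F), (B y : F)⟫
  pos : 0 < r
  summable : ∀ (x : D) (t : ℝ), |t| < r →
    Summable fun n : ℕ => |t| ^ n / (n.factorial : ℝ) * ‖((B ^ n) x : F)‖

/-- If `‖Bⁿ⁺¹ x‖ ≤ (a + c n) ‖Bⁿ x‖`, then `x` is an analytic vector with radius `1 / c`, by the
ratio test. -/
theorem summable_of_norm_pow_succ_le {x : D} {a c : ℝ}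
    (hc : 0 < c)
    (h : ∀ n : ℕ, ‖((B ^ (n + 1)) x : F)‖ ≤ (a + c * n) * ‖((B ^ n) x : F)‖) {t : ℝ}
    (ht : |t| < 1 / c) :
    Summable fun n : ℕ => |t| ^ n / (n.factorial : ℝ) * ‖((B ^ n) x : F)‖ := by
  have h1 : |t| * c < 1 := by rwa [lt_div_iff₀ hc] at ht
  obtain ⟨ρ, hρ1, hρ2⟩ := exists_between h1
  refine summable_of_ratio_norm_eventually_le hρ2 ?_
  have h2 : ∀ᶠ n : ℕ in atTop, |t| * a ≤ (ρ - |t| * c) * n := by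
    have : Tendsto (fun n : ℕ => (ρ - |t| * c) * (n : ℝ)) atTop atTop :=
      tendsto_natCast_atTop_atTop.const_mul_atTop (by linarith)
    exact this.eventually_ge_atTop _
  filter_upwards [h2] with n hn
  have hρ0 : 0 ≤ ρ := le_trans (by positivity) hρ1.le
  rw [Real.norm_of_nonneg (by positivity), Real.norm_of_nonneg (by positivity)]
  have h3 : |t| * (a + c * n) ≤ ρ * (n + 1) := by nlinarith
  have h4 : (0 : ℝ) < n.factorial := by exact_mod_cast n.factorial_pos
  rw [Nat.factorial_succ]
  push_cast
  calc |t| ^ (n + 1) / ((n + 1) * n.factorial) * ‖((B ^ (n + 1)) x : F)‖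
      ≤ |t| ^ (n + 1) / ((n + 1) * n.factorial) * ((a + c * n) * ‖((B ^ n) x : F)‖) := by
        gcongr; exact h n
    _ = |t| ^ n / ((n + 1) * n.factorial) * ‖((B ^ n) x : F)‖ * (|t| * (a + c * n)) := by ring
    _ ≤ |t| ^ n / ((n + 1) * n.factorial) * ‖((B ^ n) x : F)‖ * (ρ * (n + 1)) := by gcongr
    _ = ρ * (|t| ^ n / n.factorial * ‖((B ^ n) x : F)‖) := by field_simp

/-- The powers of a restriction are the restrictions of the powers. -/
theorem coe_pow_restrict {D' : Submodule ℂ F} {B' : D' →ₗ[ℂ] D'}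
    (hle : D' ≤ D) (hB : ∀ x : D', (B' x : F) = B (Submodule.inclusion hle x)) (n : ℕ) (x : D') :
    ((B' ^ n) x : F) = (B ^ n) (Submodule.inclusion hle x) := by
  induction n generalizing x with
  | zero => rfl
  | succ n ih =>
    rw [pow_succ, pow_succ, Module.End.mul_apply, Module.End.mul_apply, ih]
    congr 2
    exact Subtype.ext (hB x)

theorem IsAnalyticSkew.restrict {D' : Submodule ℂ F} {B' : D' →ₗ[ℂ] D'}
    (h : IsAnalyticSkew D B r) (hle : D' ≤ D) (hd : Dense (D' : Set F))
    (hB : ∀ x : D', (B' x : F) = B (Submodule.inclusion hle x)) : IsAnalyticSkew D' B' r where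
  dense := hd
  skew x y := by
    rw [hB, hB]
    exact h.skew (Submodule.inclusion hle x) (Submodule.inclusion hle y)
  pos := h.pos
  summable x t ht := by
    simp_rw [coe_pow_restrict hle hB]
    exact h.summable _ t ht

namespace IsAnalyticSkew

theorem skew_pow (h : IsAnalyticSkew D B r) (n : ℕ) (x y : D) :
    ⟪((B ^ n) x : F), (y : F)⟫ = (-1) ^ n * ⟪(x : F), ((B ^ n) y : F)⟫ := by
  induction n generalizing y with
  | zero => simp
  | succ n ih =>
    rw [pow_succ', Module.End.mul_apply, h.skew, ih, ← Module.End.mul_apply, ← pow_succ, pow_succ',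
      pow_succ]
    ring

theorem summable_norm (h : IsAnalyticSkew D B r) (x : D) {z : ℂ} (hz : ‖z‖ < r) :
    Summable fun n : ℕ => ‖(z ^ n / (n.factorial : ℂ)) • ((B ^ n) x : F)‖ := by
  have := h.summable x ‖z‖ (by rwa [abs_norm])
  refine this.congr fun n => ?_
  rw [norm_smul, norm_div, norm_pow, abs_norm, Complex.norm_natCast]

theorem inner_closedGraph (h : IsAnalyticSkew D B r) {p q : F × F} (hp : p ∈ closedGraph B)
    (hq : q ∈ closedGraph B) : ⟪p.2, q.1⟫ = -⟪p.1, q.2⟫ := by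
  refine closedGraph_induction (P := fun p => ⟪p.2, q.1⟫ = -⟪p.1, q.2⟫)
    (isClosed_eq (by fun_prop) (by fun_prop)) (fun x => ?_) hp
  exact closedGraph_induction (P := fun q => ⟪(B x : F), q.1⟫ = -⟪(x : F), q.2⟫)
    (isClosed_eq (by fun_prop) (by fun_prop)) (fun y => h.skew x y) hq

theorem snd_eq_zero_of_mem_closedGraph (h : IsAnalyticSkew D B r) {y : F}
    (hy : ((0 : F), y) ∈ closedGraph B) : y = 0 := by
  refine h.dense.eq_zero_of_inner_left ℂ fun x hx => ?_
  simpa using h.inner_closedGraph hy (mem_closedGraph ⟨x, hx⟩)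

theorem isClosable (h : IsAnalyticSkew D B r) : (toPMap B).IsClosable :=
  (isClosable_and_graph_closure fun _ => h.snd_eq_zero_of_mem_closedGraph).1

theorem graph_closure (h : IsAnalyticSkew D B r) : (toPMap B).closure.graph = closedGraph B :=
  (isClosable_and_graph_closure fun _ => h.snd_eq_zero_of_mem_closedGraph).2

variable {A : D →ₗ[ℂ] D}

theorem snd_eq_zero_of_mem_closedGraph_of_I_smul (h : IsAnalyticSkew D (Complex.I • A) r) (y : F)
    (hy : ((0 : F), y) ∈ closedGraph A) : y = 0 := by
  rw [← mem_closedGraph_smul_iff A Complex.I_ne_zero] at hy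
  exact (smul_eq_zero.mp (h.snd_eq_zero_of_mem_closedGraph hy)).resolve_left Complex.I_ne_zero

theorem graph_closure_of_I_smul (h : IsAnalyticSkew D (Complex.I • A) r) :
    (toPMap A).closure.graph = closedGraph A :=
  (isClosable_and_graph_closure h.snd_eq_zero_of_mem_closedGraph_of_I_smul).2

theorem isAnalyticVector (h : IsAnalyticSkew D (Complex.I • A) r)
    {x : F} (hx : x ∈ D) :
    IsAnalyticVector (toPMap A) r x := by
  refine ⟨fun n => (A ^ n) ⟨x, hx⟩, rfl, fun n => ?_, fun t ht => ?_⟩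
  · exact congrArg (fun T : Module.End ℂ D => (T ⟨x, hx⟩ : F)) (pow_succ' A n)
  · refine (h.summable ⟨x, hx⟩ t ht).congr fun n => ?_
    rw [smul_pow, LinearMap.smul_apply, Submodule.coe_smul, norm_smul]
    simp

variable (B) in
/-- The exponential series `∑ zⁿ / n! Bⁿ x`, with the default value `0` where it diverges. -/
def expSum (z : ℂ) (x : D) : F :=
  ∑' n : ℕ, (z ^ n / (n.factorial : ℂ)) • ((B ^ n) x : F)

/-- A number of steps that is large enough for `t / k` to be less than `r` in absolute value. -/
def steps (_h : IsAnalyticSkew D B r) (t : ℝ) : ℕ := ⌊|t| / r⌋₊ + 1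

theorem abs_div_steps_lt (h : IsAnalyticSkew D B r) (t : ℝ) : |t / h.steps t| < r := by
  have h1 : |t| / r < h.steps t := by
    rw [steps]; push_cast; exact Nat.lt_floor_add_one _
  have h2 : (0 : ℝ) < h.steps t := by rw [steps]; positivity
  rw [abs_div, Nat.abs_cast, div_lt_iff₀ h2]
  rw [div_lt_iff₀ h.pos] at h1
  linarith

end IsAnalyticSkew

variable [CompleteSpace F]

/-! ### The unitary group of an operator with analytic vectors -/

namespace IsAnalyticSkew

theorem hasSum_expSum (h : IsAnalyticSkew D B r) (x : D) {z : ℂ} (hz : ‖z‖ < r) :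
    HasSum (fun n : ℕ => (z ^ n / (n.factorial : ℂ)) • ((B ^ n) x : F)) (expSum B z x) :=
  (h.summable_norm x hz).of_norm.hasSum

/-- The group law in terms of the exponential series: formally the two sides are
`⟪exp (s B) x, exp (t B) y⟫` and `⟪x, exp ((t - s) B) y⟫`. The series of `exp ((t - s) B) y`
itself need not converge, since `|t - s| < r` is not assumed. -/
theorem inner_expSum (h : IsAnalyticSkew D B r) {s t : ℝ} (hs : |s| < r) (ht : |t| < r) (x y : D) :
    HasSum (fun N : ℕ => ((t - s : ℝ) : ℂ) ^ N / (N.factorial : ℂ) * ⟪(x : F), ((B ^ N) y : F)⟫)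
      ⟪expSum B s x, expSum B t y⟫ := by
  have hs' : ‖(s : ℂ)‖ < r := by simpa using hs
  have ht' : ‖(t : ℂ)‖ < r := by simpa using ht
  have := hasSum_antidiagonal_of_bilinear (isBoundedBilinearMap_inner (𝕜 := ℂ) (E := F))
    (h.hasSum_expSum x hs') (h.hasSum_expSum y ht') (h.summable_norm x hs') (h.summable_norm y ht')
  refine this.congr_fun fun N => ?_
  have e : ((t - s : ℝ) : ℂ) = -s + t := by push_cast; ring
  rw [e, ← sum_antidiagonal_pow_div_factorial, Finset.sum_mul]
  refine Finset.sum_congr rfl fun p hp => ?_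
  obtain rfl := (mem_antidiagonal.mp hp).symm
  rw [inner_smul_left, inner_smul_right, h.skew_pow, pow_add, Module.End.mul_apply]
  simp only [map_div₀, map_pow, Complex.conj_ofReal, map_natCast]
  rw [neg_pow (s : ℂ)]
  ring

theorem norm_expSum (h : IsAnalyticSkew D B r) {t : ℝ} (ht : |t| < r) (x : D) :
    ‖expSum B t x‖ = ‖(x : F)‖ := by
  have h1 := h.inner_expSum ht ht x x
  have h2 : HasSum (fun N : ℕ => ((t - t : ℝ) : ℂ) ^ N / (N.factorial : ℂ) *
      ⟪(x : F), ((B ^ N) x : F)⟫) ⟪(x : F), (x : F)⟫ := by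
    convert hasSum_single 0 ?_ using 1
    · simp
    · intro n hn
      simp [hn]
  have h3 := h1.unique h2
  rw [inner_self_eq_norm_sq_to_K, inner_self_eq_norm_sq_to_K] at h3
  have h4 : ‖expSum B t x‖ ^ 2 = ‖(x : F)‖ ^ 2 := by exact_mod_cast h3
  exact (pow_left_inj₀ (norm_nonneg _) (norm_nonneg _) two_ne_zero).mp h4

/-- The bounded extension to `F` of `x ↦ ∑ tⁿ / n! Bⁿ x`, for `|t| < r`; the default value `0` is
taken for other `t`. -/
def localExp (h : IsAnalyticSkew D B r) (t : ℝ) : F →L[ℂ] F :=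
  if ht : |t| < r then
    ((LinearMap.mkContinuous (σ := RingHom.id ℂ)
      { toFun := expSum B t
        map_add' := fun x y => by
          have ht' : ‖(t : ℂ)‖ < r := by simpa using ht
          refine (h.hasSum_expSum (x + y) ht').unique
            (((h.hasSum_expSum x ht').add (h.hasSum_expSum y ht')).congr_fun fun n => ?_)
          simp
        map_smul' := fun c x => by
          have ht' : ‖(t : ℂ)‖ < r := by simpa using ht
          refine (h.hasSum_expSum (c • x) ht').unique
            (((h.hasSum_expSum x ht').const_smul c).congr_fun fun n => ?_)
          simp [smul_comm c] } 1 fun x => by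
            rw [one_mul]; exact (h.norm_expSum ht x).le)).extend D.subtypeL
  else 0

theorem localExp_apply (h : IsAnalyticSkew D B r) {t : ℝ} (ht : |t| < r) (x : D) :
    h.localExp t x = expSum B t x := by
  rw [localExp, dif_pos ht]
  exact ContinuousLinearMap.extend_eq _ h.dense.denseRange_val
    isUniformEmbedding_subtype_val.isUniformInducing x

theorem hasSum_localExp (h : IsAnalyticSkew D B r) {t : ℝ} (ht : |t| < r) (x : D) :
    HasSum (fun n : ℕ => ((t : ℂ) ^ n / (n.factorial : ℂ)) • ((B ^ n) x : F))
      (h.localExp t x) := by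
  rw [h.localExp_apply ht]
  exact h.hasSum_expSum x (by simpa using ht)

/-- The continuous extension of `inner_expSum`. The cases `s = t`, `t = 0` and the general case
give in turn isometry, the adjoint, and the group law. -/
theorem inner_localExp (h : IsAnalyticSkew D B r) {s t : ℝ} (hs : |s| < r) (ht : |t| < r)
    (hst : |t - s| < r) (x y : F) :
    ⟪h.localExp s x, h.localExp t y⟫ = ⟪x, h.localExp (t - s) y⟫ := by
  refine h.dense.induction (P := fun x => ∀ y, ⟪h.localExp s x, h.localExp t y⟫ =
    ⟪x, h.localExp (t - s) y⟫) (fun x hx y => ?_) ?_ x y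
  · refine h.dense.induction (P := fun y => ⟪h.localExp s x, h.localExp t y⟫ =
      ⟪x, h.localExp (t - s) y⟫) (fun y hy => ?_) ?_ y
    · have h1 := h.inner_expSum hs ht ⟨x, hx⟩ ⟨y, hy⟩
      rw [← h.localExp_apply hs, ← h.localExp_apply ht] at h1
      refine h1.unique ?_
      have h2 := (innerSL ℂ x).hasSum (h.hasSum_localExp hst ⟨y, hy⟩)
      refine h2.congr_fun fun n => ?_
      simp
    · exact isClosed_eq (by fun_prop) (by fun_prop)
  · simp only [Set.ofPred_forall]
    exact isClosed_iInter fun y => isClosed_eq (by fun_prop) (by fun_prop)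

theorem localExp_zero (h : IsAnalyticSkew D B r) : h.localExp 0 = 1 := by
  refine ContinuousLinearMap.ext fun x => ?_
  refine h.dense.induction (P := fun x => h.localExp 0 x = (1 : F →L[ℂ] F) x) (fun x hx => ?_) ?_ x
  · refine (h.hasSum_localExp (by simpa using h.pos) ⟨x, hx⟩).unique ?_
    convert hasSum_single 0 ?_ using 1
    · simp
    · intro n hn
      simp [hn]
  · exact isClosed_eq (by fun_prop) (by fun_prop)

theorem adjoint_localExp (h : IsAnalyticSkew D B r) {t : ℝ} (ht : |t| < r) :
    star (h.localExp t) = h.localExp (-t) := by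
  refine ContinuousLinearMap.ext fun y => ext_inner_left ℂ fun x => ?_
  have := h.inner_localExp (s := t) (t := 0) ht (by simpa using h.pos) (by simpa using ht) x y
  rw [ContinuousLinearMap.star_eq_adjoint, ContinuousLinearMap.adjoint_inner_right]
  simpa [h.localExp_zero] using this

theorem localExp_add (h : IsAnalyticSkew D B r) {s t : ℝ} (hs : |s| < r) (ht : |t| < r)
    (hst : |s + t| < r) : h.localExp (s + t) = h.localExp s * h.localExp t := by
  refine ContinuousLinearMap.ext fun y => ext_inner_left ℂ fun x => ?_
  have := h.inner_localExp (s := -s) (t := t) (by simpa using hs) ht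
    (by rwa [sub_neg_eq_add, add_comm]) x y
  rw [sub_neg_eq_add, add_comm t s, ← h.adjoint_localExp hs, ContinuousLinearMap.star_eq_adjoint,
    ContinuousLinearMap.adjoint_inner_left] at this
  exact this.symm

theorem localExp_div_pow (h : IsAnalyticSkew D B r) {t : ℝ} (ht : |t| < r) (m : ℕ) (hm : m ≠ 0) :
    h.localExp (t / m) ^ m = h.localExp t := by
  have hm' : (0 : ℝ) < m := by exact_mod_cast Nat.pos_of_ne_zero hm
  have key : ∀ j : ℕ, j ≤ m → |j * (t / m)| < r := fun j hj => by
    refine lt_of_le_of_lt ?_ ht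
    have : (j : ℝ) / m ≤ 1 := (div_le_one hm').mpr (by exact_mod_cast hj)
    calc |j * (t / m)| = (j / m) * |t| := by
          rw [abs_mul, abs_div, Nat.abs_cast, Nat.abs_cast]; ring
      _ ≤ 1 * |t| := by gcongr
      _ = |t| := one_mul _
  have key1 : |t / m| < r := by
    simpa using key 1 (Nat.one_le_iff_ne_zero.mpr hm)
  have : ∀ j : ℕ, j ≤ m → h.localExp (t / m) ^ j = h.localExp (j * (t / m)) := by
    intro j
    induction j with
    | zero => intro _; simp [h.localExp_zero]
    | succ j ih =>
      intro hj
      have e : ((j + 1 : ℕ) : ℝ) * (t / m) = j * (t / m) + t / m := by push_cast; ring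
      rw [pow_succ, ih (by omega), e, h.localExp_add (key j (by omega)) key1 (e ▸ key _ hj)]
  rw [this m le_rfl, mul_div_cancel₀ t hm'.ne']

/-- The operator `exp (t B)` for arbitrary `t`, as a power of an operator `exp (t / k B)`. -/
def globalExp (h : IsAnalyticSkew D B r) (t : ℝ) : F →L[ℂ] F :=
  h.localExp (t / h.steps t) ^ h.steps t

/-- The operator `exp (t B)` may be computed with any sufficiently large number of steps. -/
theorem globalExp_eq (h : IsAnalyticSkew D B r) {t : ℝ} {k : ℕ} (hk : k ≠ 0) (ht : |t / k| < r) :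
    h.globalExp t = h.localExp (t / k) ^ k := by
  have h1 := h.abs_div_steps_lt t
  have h2 : h.steps t ≠ 0 := by simp [steps]
  -- Both sides are powers of `exp (t / (k * l) B)`, with `l` the chosen number of steps.
  rw [globalExp, ← h.localExp_div_pow h1 k hk, ← h.localExp_div_pow ht _ h2, ← pow_mul, ← pow_mul,
    mul_comm k, div_div, div_div, mul_comm (k : ℝ)]

theorem globalExp_eq_localExp (h : IsAnalyticSkew D B r) {t : ℝ} (ht : |t| < r) :
    h.globalExp t = h.localExp t := by
  rw [h.globalExp_eq one_ne_zero (by simpa using ht)]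
  simp

theorem globalExp_add (h : IsAnalyticSkew D B r) (s t : ℝ) :
    h.globalExp (s + t) = h.globalExp s * h.globalExp t := by
  -- A number of steps that works for `s`, `t` and `s + t` at once.
  obtain ⟨k, hk⟩ := exists_nat_gt ((|s| + |t|) / r)
  have hk0 : (0 : ℝ) < k := lt_of_le_of_lt (by have := h.pos; positivity) hk
  have hk1 : k ≠ 0 := by rintro rfl; simp at hk0
  rw [div_lt_iff₀ h.pos] at hk
  have aux : ∀ x : ℝ, |x| ≤ |s| + |t| → |x / k| < r := fun x hx => by
    rw [abs_div, Nat.abs_cast, div_lt_iff₀ hk0]; linarith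
  have hs := aux s (by linarith [abs_nonneg t])
  have ht := aux t (by linarith [abs_nonneg s])
  have hst := aux (s + t) (abs_add_le s t)
  rw [h.globalExp_eq hk1 hs, h.globalExp_eq hk1 ht, h.globalExp_eq hk1 hst, ← Commute.mul_pow]
  · rw [← h.localExp_add hs ht (by rwa [← add_div]), add_div]
  · rw [Commute, SemiconjBy, ← h.localExp_add hs ht (by rwa [← add_div]), add_comm,
      ← h.localExp_add ht hs (by rwa [← add_div, add_comm])]

theorem globalExp_zero (h : IsAnalyticSkew D B r) : h.globalExp 0 = 1 := by
  rw [h.globalExp_eq_localExp (by simpa using h.pos), h.localExp_zero]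

theorem star_globalExp (h : IsAnalyticSkew D B r) (t : ℝ) :
    star (h.globalExp t) = h.globalExp (-t) := by
  have h1 := h.abs_div_steps_lt t
  have h2 : h.steps t ≠ 0 := by simp [steps]
  rw [globalExp, star_pow, h.adjoint_localExp h1, ← neg_div,
    ← h.globalExp_eq h2 (by rwa [neg_div, abs_neg])]

theorem globalExp_mem_unitary (h : IsAnalyticSkew D B r) (t : ℝ) :
    h.globalExp t ∈ unitary (F →L[ℂ] F) := by
  rw [Unitary.mem_iff, h.star_globalExp, ← h.globalExp_add, ← h.globalExp_add]
  simp [h.globalExp_zero]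

theorem norm_globalExp_apply (h : IsAnalyticSkew D B r) (t : ℝ) (x : F) :
    ‖h.globalExp t x‖ = ‖x‖ :=
  ContinuousLinearMap.norm_map_of_mem_unitary (h.globalExp_mem_unitary t) x

theorem hasDerivAt_globalExp_zero (h : IsAnalyticSkew D B r) (x : D) :
    HasDerivAt (fun t : ℝ => h.globalExp t x) (B x : F) 0 := by
  let p : FormalMultilinearSeries ℂ ℂ F := fun n =>
    ContinuousMultilinearMap.mkPiRing ℂ (Fin n) ((1 / (n.factorial : ℂ)) • ((B ^ n) x : F))
  have h1 : HasFPowerSeriesAt (fun z : ℂ => expSum B z x) p 0 := by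
    rw [hasFPowerSeriesAt_iff]
    filter_upwards [Metric.ball_mem_nhds (0 : ℂ) h.pos] with z hz
    rw [zero_add]
    refine (h.hasSum_expSum x (by simpa using hz)).congr_fun fun n => ?_
    simp [p, FormalMultilinearSeries.coeff, smul_smul, div_eq_mul_inv]
  have h2 := h1.hasDerivAt
  have h3 : HasDerivAt (fun z : ℂ => expSum B z x) (B x : F) ((0 : ℝ) : ℂ) := by
    simpa [p] using h2
  have h4 := h3.scomp (0 : ℝ) Complex.ofRealCLM.hasDerivAt
  simp only [Complex.ofRealCLM_apply, Complex.ofReal_one, one_smul] at h4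
  refine h4.congr_of_eventuallyEq ?_
  filter_upwards [Metric.ball_mem_nhds (0 : ℝ) h.pos] with t ht
  have ht : |t| < r := by simpa using ht
  exact (h.globalExp_eq_localExp ht).symm ▸ h.localExp_apply ht x

theorem continuous_globalExp (h : IsAnalyticSkew D B r) (x : F) :
    Continuous fun t : ℝ => h.globalExp t x := by
  -- Continuity at `0` holds on `D` by differentiability, and then everywhere because the operators
  -- are isometric.
  have h0 : ∀ x : F, Tendsto (fun t : ℝ => h.globalExp t x) (𝓝 0) (𝓝 x) := by
    intro x
    rw [Metric.tendsto_nhds]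
    intro ε hε
    obtain ⟨y, hy, hxy⟩ := Metric.dense_iff.mp h.dense x (ε / 3) (by positivity)
    have hyx : ‖x - y‖ < ε / 3 := by
      rw [← dist_eq_norm, dist_comm]; exact hy
    have h1 := (h.hasDerivAt_globalExp_zero ⟨y, hxy⟩).continuousAt
    rw [ContinuousAt, Metric.tendsto_nhds] at h1
    filter_upwards [h1 (ε / 3) (by positivity)] with t ht
    simp only [h.globalExp_zero, one_apply_eq_self] at ht
    rw [dist_eq_norm] at ht ⊢
    have e : h.globalExp t x - x = h.globalExp t (x - y) + (h.globalExp t y - y) - (x - y) := by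
      rw [map_sub]; abel
    rw [e]
    calc _ ≤ ‖h.globalExp t (x - y)‖ + ‖h.globalExp t y - y‖ + ‖x - y‖ :=
          (norm_sub_le _ _).trans (by gcongr; exact norm_add_le _ _)
      _ < ε := by rw [h.norm_globalExp_apply]; linarith
  refine continuous_iff_continuousAt.mpr fun s => ?_
  have h1 : Tendsto (fun t : ℝ => t - s) (𝓝 s) (𝓝 0) := by
    have : Continuous fun t : ℝ => t - s := by fun_prop
    simpa using this.tendsto s
  have h2 := ((h.globalExp s).continuous.tendsto x).comp ((h0 x).comp h1)
  refine h2.congr fun t => ?_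
  change (h.globalExp s * h.globalExp (t - s)) x = _
  rw [← h.globalExp_add, add_sub_cancel]

/-- The unitary group `t ↦ exp (t B)`. -/
def group (h : IsAnalyticSkew D B r) : UnitaryGroup F where
  toFun t := ⟨h.globalExp t, h.globalExp_mem_unitary t⟩
  map_zero := Subtype.ext h.globalExp_zero
  map_add s t := Subtype.ext (h.globalExp_add s t)
  strongly_continuous := h.continuous_globalExp

theorem group_apply (h : IsAnalyticSkew D B r) (t : ℝ) :
    (h.group.toFun t : F →L[ℂ] F) = h.globalExp t := rfl

theorem hasSum_group (h : IsAnalyticSkew D B r) {t : ℝ} (ht : |t| < r) (x : D) :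
    HasSum (fun n : ℕ => ((t : ℂ) ^ n / (n.factorial : ℂ)) • ((B ^ n) x : F))
      ((h.group.toFun t : F →L[ℂ] F) x) := by
  rw [group_apply, h.globalExp_eq_localExp ht]
  exact h.hasSum_localExp ht x

end IsAnalyticSkew

/-! ### Generators of unitary groups -/

namespace UnitaryGroup

variable (U : UnitaryGroup F)

theorem zero_apply (x : F) : (U.toFun 0 : F →L[ℂ] F) x = x := by
  rw [U.map_zero]; rfl

theorem add_apply (s t : ℝ) (x : F) :
    (U.toFun (s + t) : F →L[ℂ] F) x =
      (U.toFun s : F →L[ℂ] F) ((U.toFun t : F →L[ℂ] F) x) := by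
  rw [U.map_add]; rfl

theorem norm_apply (t : ℝ) (x : F) : ‖(U.toFun t : F →L[ℂ] F) x‖ = ‖x‖ :=
  ContinuousLinearMap.norm_map_of_mem_unitary (U.toFun t).2 x

theorem inner_apply (t : ℝ) (x y : F) :
    ⟪(U.toFun t : F →L[ℂ] F) x, (U.toFun t : F →L[ℂ] F) y⟫ = ⟪x, y⟫ :=
  ContinuousLinearMap.inner_map_map_of_mem_unitary (U.toFun t).2 x y

theorem star_eq (t : ℝ) : star (U.toFun t : F →L[ℂ] F) = (U.toFun (-t) : F →L[ℂ] F) := by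
  have h : U.toFun (-t) * U.toFun t = 1 := by rw [← U.map_add, neg_add_cancel, U.map_zero]
  rw [← Unitary.coe_star, eq_inv_of_mul_eq_one_left h]
  rfl

theorem apply_neg_apply (t : ℝ) (x : F) :
    (U.toFun t : F →L[ℂ] F) ((U.toFun (-t) : F →L[ℂ] F) x) = x := by
  rw [← U.add_apply, add_neg_cancel, U.zero_apply]

variable {U}

/-- A unitary group is differentiable at all times on the domain of its generator. -/
theorem hasDerivAt_apply {x y : F}
    (h : HasDerivAt (fun t : ℝ => (U.toFun t : F →L[ℂ] F) x) y 0) (t : ℝ) :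
    HasDerivAt (fun t : ℝ => (U.toFun t : F →L[ℂ] F) x) ((U.toFun t : F →L[ℂ] F) y) t := by
  have h1 : HasDerivAt (fun s : ℝ => (U.toFun (s - t) : F →L[ℂ] F) x) y t := by
    have h0 : HasDerivAt (fun t : ℝ => (U.toFun t : F →L[ℂ] F) x) y (t - t) := by
      rwa [sub_self]
    exact h0.comp_sub_const t t
  have h2 := ((U.toFun t : F →L[ℂ] F).restrictScalars ℝ).hasFDerivAt.comp_hasDerivAt t h1
  refine h2.congr_of_eventuallyEq (Eventually.of_forall fun s => ?_)
  change _ = (U.toFun t : F →L[ℂ] F) ((U.toFun (s - t) : F →L[ℂ] F) x)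
  rw [← U.add_apply, add_sub_cancel]

/-- The domain of the generator is invariant under the group, and the generator commutes with the
group. -/
theorem hasDerivAt_comm {x y : F}
    (h : HasDerivAt (fun t : ℝ => (U.toFun t : F →L[ℂ] F) x) y 0) (s : ℝ) :
    HasDerivAt (fun t : ℝ => (U.toFun t : F →L[ℂ] F) ((U.toFun s : F →L[ℂ] F) x))
      ((U.toFun s : F →L[ℂ] F) y) 0 := by
  have h2 := ((U.toFun s : F →L[ℂ] F).restrictScalars ℝ).hasFDerivAt.comp_hasDerivAt 0 h
  refine h2.congr_of_eventuallyEq (Eventually.of_forall fun t => ?_)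
  change (U.toFun t : F →L[ℂ] F) ((U.toFun s : F →L[ℂ] F) x) =
    (U.toFun s : F →L[ℂ] F) ((U.toFun t : F →L[ℂ] F) x)
  rw [← U.add_apply, ← U.add_apply, add_comm]

/-- The derivatives of a unitary group at `0` are skew-symmetric. -/
theorem inner_hasDerivAt {x y x' y' : F}
    (h : HasDerivAt (fun t : ℝ => (U.toFun t : F →L[ℂ] F) x) y 0)
    (h' : HasDerivAt (fun t : ℝ => (U.toFun t : F →L[ℂ] F) x') y' 0) :
    ⟪y, x'⟫ = -⟪x, y'⟫ := by
  have h1 := h.inner ℂ h'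
  simp only [U.inner_apply, U.zero_apply] at h1
  have h2 := h1.unique (hasDerivAt_const 0 ⟪x, x'⟫)
  linear_combination h2

/-- The integrated form of the definition of the generator, which is stable under limits. -/
theorem sub_eq_integral {x y : F}
    (h : HasDerivAt (fun t : ℝ => (U.toFun t : F →L[ℂ] F) x) y 0) (t : ℝ) :
    (U.toFun t : F →L[ℂ] F) x - x = ∫ s in (0 : ℝ)..t, (U.toFun s : F →L[ℂ] F) y := by
  rw [intervalIntegral.integral_eq_sub_of_hasDerivAt (fun s _ => hasDerivAt_apply h s)
    ((U.strongly_continuous y).intervalIntegrable _ _), U.zero_apply]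

theorem hasDerivAt_of_sub_eq_integral {x y : F}
    (h : ∀ t : ℝ, (U.toFun t : F →L[ℂ] F) x - x =
      ∫ s in (0 : ℝ)..t, (U.toFun s : F →L[ℂ] F) y) :
    HasDerivAt (fun t : ℝ => (U.toFun t : F →L[ℂ] F) x) y 0 := by
  have h1 := intervalIntegral.integral_hasDerivAt_right (a := (0 : ℝ)) (b := 0)
    ((U.strongly_continuous y).intervalIntegrable _ _)
    ((U.strongly_continuous y).stronglyMeasurableAtFilter _ _)
    (U.strongly_continuous y).continuousAt
  rw [U.zero_apply] at h1
  refine (h1.add_const x).congr_of_eventuallyEq (Eventually.of_forall fun t => ?_)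
  change _ = (∫ s in (0 : ℝ)..t, (U.toFun s : F →L[ℂ] F) y) + x
  rw [← h t, sub_add_cancel]

variable (U) in
/-- The generator of a unitary group is a closed relation. -/
theorem isClosed_setOf_hasDerivAt :
    IsClosed {p : F × F | HasDerivAt (fun t : ℝ => (U.toFun t : F →L[ℂ] F) p.1) p.2 0} := by
  have e : {p : F × F | HasDerivAt (fun t : ℝ => (U.toFun t : F →L[ℂ] F) p.1) p.2 0} =
      {p : F × F | ∀ t : ℝ, (U.toFun t : F →L[ℂ] F) p.1 - p.1 =
        ∫ s in (0 : ℝ)..t, (U.toFun s : F →L[ℂ] F) p.2} :=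
    Set.ext fun p => ⟨sub_eq_integral, hasDerivAt_of_sub_eq_integral⟩
  rw [e]
  simp only [Set.ofPred_forall]
  refine isClosed_iInter fun t => isClosed_eq (by fun_prop) ?_
  -- The integral depends on `y` in a Lipschitz continuous way, because the group is isometric.
  have hc : Continuous fun y : F => ∫ s in (0 : ℝ)..t, (U.toFun s : F →L[ℂ] F) y := by
    refine LipschitzWith.continuous (K := ⟨|t|, abs_nonneg t⟩) (LipschitzWith.of_dist_le_mul
      fun y z => ?_)
    rw [dist_eq_norm, ← intervalIntegral.integral_sub
      ((U.strongly_continuous y).intervalIntegrable _ _)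
      ((U.strongly_continuous z).intervalIntegrable _ _), dist_eq_norm]
    have := intervalIntegral.norm_integral_le_of_norm_le_const (a := (0 : ℝ)) (b := t)
      (f := fun s => (U.toFun s : F →L[ℂ] F) y - (U.toFun s : F →L[ℂ] F) z) (C := ‖y - z‖)
      fun s _ => by rw [← map_sub, U.norm_apply]
    rw [sub_zero, mul_comm] at this
    exact this
  exact hc.comp continuous_snd

/-- A unitary group is determined by its generator. -/
theorem eq_of_hasDerivAt {V : UnitaryGroup F} {S : Set F} (hS : Dense S)
    (h : ∀ x y : F, HasDerivAt (fun t : ℝ => (U.toFun t : F →L[ℂ] F) x) y 0 ↔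
      HasDerivAt (fun t : ℝ => (V.toFun t : F →L[ℂ] F) x) y 0)
    (hd : ∀ x ∈ S, ∃ y, HasDerivAt (fun t : ℝ => (U.toFun t : F →L[ℂ] F) x) y 0) : U = V := by
  -- The inner product of `U t x` and `V t y` has derivative zero, by skew-symmetry of the common
  -- generator.
  have key : ∀ x ∈ S, ∀ y ∈ S, ∀ t : ℝ,
      ⟪(U.toFun t : F →L[ℂ] F) x, (V.toFun t : F →L[ℂ] F) y⟫ = ⟪x, y⟫ := by
    intro x hx y hy t
    obtain ⟨x', hx'⟩ := hd x hx
    obtain ⟨y', hy'⟩ := hd y hy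
    rw [h] at hy'
    have h1 : ∀ s : ℝ, HasDerivAt (fun s : ℝ =>
        ⟪(U.toFun s : F →L[ℂ] F) x, (V.toFun s : F →L[ℂ] F) y⟫) 0 s := by
      intro s
      have h2 := (hasDerivAt_apply hx' s).inner ℂ (hasDerivAt_apply hy' s)
      have h3 := inner_hasDerivAt ((h _ _).mp (hasDerivAt_comm hx' s)) (hasDerivAt_comm hy' s)
      rwa [h3, add_neg_cancel] at h2
    have h4 := is_const_of_deriv_eq_zero (fun s => (h1 s).differentiableAt)
      (fun s => (h1 s).deriv) t 0
    simpa [U.zero_apply, V.zero_apply] using h4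
  have key2 : ∀ t x y, ⟪(U.toFun t : F →L[ℂ] F) x, (V.toFun t : F →L[ℂ] F) y⟫ = ⟪x, y⟫ := by
    intro t x y
    refine hS.induction (P := fun x => ⟪(U.toFun t : F →L[ℂ] F) x,
      (V.toFun t : F →L[ℂ] F) y⟫ = ⟪x, y⟫) (fun x hx => ?_) ?_ x
    · refine hS.induction (P := fun y => ⟪(U.toFun t : F →L[ℂ] F) x,
        (V.toFun t : F →L[ℂ] F) y⟫ = ⟪x, y⟫) (fun y hy => key x hx y hy t) ?_ y
      exact isClosed_eq (by fun_prop) (by fun_prop)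
    · exact isClosed_eq (by fun_prop) (by fun_prop)
  refine UnitaryGroup.ext (funext fun t => Subtype.ext (ContinuousLinearMap.ext fun y => ?_))
  refine ext_inner_left ℂ fun x => ?_
  have := key2 t ((U.toFun (-t) : F →L[ℂ] F) x) y
  rw [U.apply_neg_apply] at this
  rw [this]
  have := U.inner_apply t ((U.toFun (-t) : F →L[ℂ] F) x) y
  rw [U.apply_neg_apply] at this
  exact this

/-- The conjugate of a unitary group by a unitary operator of another one. -/
def conj (W E : UnitaryGroup F) (l : ℝ) : UnitaryGroup F where
  toFun t := E.toFun l * W.toFun t * E.toFun (-l)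
  map_zero := by rw [W.map_zero, mul_one, ← E.map_add, add_neg_cancel, E.map_zero]
  map_add s t := by
    have h : E.toFun (-l) * E.toFun l = 1 := by rw [← E.map_add, neg_add_cancel, E.map_zero]
    rw [W.map_add]
    simp only [mul_assoc]
    rw [← mul_assoc (E.toFun (-l)) (E.toFun l), h, one_mul]
  strongly_continuous x :=
    (E.toFun l : F →L[ℂ] F).continuous.comp
      (W.strongly_continuous ((E.toFun (-l) : F →L[ℂ] F) x))

end UnitaryGroup

/-! ### Skew-adjointness of the closure -/

namespace IsAnalyticSkew

/-- The range of `B ± 1` is dense: the deficiency indices of `B` vanish. -/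
theorem eq_zero_of_orthogonal (h : IsAnalyticSkew D B r) {κ : ℝ} (hκ : κ = 1 ∨ κ = -1) {w : F}
    (hw : ∀ x : D, ⟪w, (B x : F) + (κ : ℂ) • (x : F)⟫ = 0) : w = 0 := by
  have hpow : ∀ (n : ℕ) (x : D), ⟪w, ((B ^ n) x : F)⟫ = (-κ : ℂ) ^ n * ⟪w, (x : F)⟫ := by
    intro n
    induction n with
    | zero => simp
    | succ n ih =>
      intro x
      have := hw x
      rw [inner_add_right, inner_smul_right] at this
      rw [pow_succ, Module.End.mul_apply, ih, pow_succ, eq_neg_of_add_eq_zero_left this]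
      ring
  -- At the time `-κ r / 2`, the factor `exp (-κ t)` is `exp (r / 2) > 1`.
  have hr := h.pos
  have ht : |-κ * (r / 2)| < r := by
    have : |κ| = 1 := by rcases hκ with rfl | rfl <;> simp
    rw [abs_mul, abs_neg, this, one_mul, abs_of_pos (by positivity)]
    linarith
  have hD : ∀ x : F, ⟪w, (h.group.toFun (-κ * (r / 2)) : F →L[ℂ] F) x⟫ =
      Complex.exp (r / 2 : ℝ) * ⟪w, x⟫ := by
    intro x
    refine h.dense.induction (P := fun x => ⟪w, (h.group.toFun (-κ * (r / 2)) : F →L[ℂ] F) x⟫ =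
      Complex.exp (r / 2 : ℝ) * ⟪w, x⟫) (fun x hx => ?_)
      (isClosed_eq (by fun_prop) (by fun_prop)) x
    have h1 := (innerSL ℂ w).hasSum (h.hasSum_group ht ⟨x, hx⟩)
    have h2 := (NormedSpace.expSeries_div_hasSum_exp ((r / 2 : ℝ) : ℂ)).mul_right ⟪w, x⟫
    rw [← Complex.exp_eq_exp_ℂ] at h2
    refine h1.unique (h2.congr_fun fun n => ?_)
    have e : (κ : ℂ) * κ = 1 := by rcases hκ with rfl | rfl <;> simp
    have e2 : ((r / 2 : ℝ) : ℂ) = ((-κ * (r / 2) : ℝ) : ℂ) * (-κ : ℂ) := by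
      push_cast; linear_combination (-(r : ℂ) / 2) * e
    rw [e2, mul_pow]
    simp only [innerSL_apply_apply, inner_smul_right, hpow]
    ring
  by_contra hne
  have hpos : 0 < ‖w‖ := norm_pos_iff.mpr hne
  have h1 := norm_inner_le_norm (𝕜 := ℂ) w ((h.group.toFun (-κ * (r / 2)) : F →L[ℂ] F) w)
  rw [hD, h.group.norm_apply, norm_mul, inner_self_eq_norm_sq_to_K, Complex.norm_exp,
    Complex.ofReal_re, norm_pow, RCLike.norm_ofReal, abs_norm] at h1
  have h2 : 1 < Real.exp (r / 2) := Real.one_lt_exp_iff.mpr (by positivity)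
  nlinarith [mul_pos hpos hpos]

/-- The closure of `B + κ` is onto, for `κ = ± 1`: its range is dense, and closed because
`‖B x + κ x‖² = ‖B x‖² + ‖x‖²`. -/
theorem exists_mem_closedGraph (h : IsAnalyticSkew D B r) {κ : ℝ} (hκ : κ = 1 ∨ κ = -1) (z : F) :
    ∃ p ∈ closedGraph B, p.2 + (κ : ℂ) • p.1 = z := by
  let T : closedGraph B →L[ℂ] F :=
    ((ContinuousLinearMap.snd ℂ F F) + (κ : ℂ) • (ContinuousLinearMap.fst ℂ F F)).comp
      (closedGraph B).subtypeL
  have hT : ∀ p : closedGraph B, T p = (p : F × F).2 + (κ : ℂ) • (p : F × F).1 := fun p => rfl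
  have : CompleteSpace (closedGraph B) :=
    (Submodule.isClosed_topologicalClosure _).completeSpace_coe
  have hn : ∀ p : closedGraph B, ‖T p‖ ^ 2 = ‖(p : F × F).2‖ ^ 2 + ‖(p : F × F).1‖ ^ 2 := by
    intro p
    have h1 : RCLike.re ⟪(p : F × F).2, (p : F × F).1⟫ = 0 := by
      have h2 := congrArg Complex.re (h.inner_closedGraph p.2 p.2)
      have h3 := congrArg Complex.re (inner_conj_symm (𝕜 := ℂ) (p : F × F).1 (p : F × F).2)
      rw [Complex.conj_re] at h3
      rw [Complex.neg_re] at h2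
      change Complex.re _ = 0
      linarith
    rw [hT, norm_add_sq (𝕜 := ℂ), inner_smul_right, norm_smul, Complex.norm_real]
    have h4 : ‖κ‖ = 1 := by rcases hκ with rfl | rfl <;> simp
    have h5 : RCLike.re ((κ : ℂ) * ⟪(p : F × F).2, (p : F × F).1⟫) = 0 := by
      change Complex.re _ = 0
      rw [Complex.re_ofReal_mul]
      exact (congrArg (κ * ·) h1).trans (mul_zero κ)
    rw [h4, h5]
    ring
  have hanti : AntilipschitzWith 1 T := by
    refine T.antilipschitz_of_bound fun p => ?_
    rw [NNReal.coe_one, one_mul]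
    change max ‖(p : F × F).1‖ ‖(p : F × F).2‖ ≤ _
    have := hn p
    refine max_le ?_ ?_ <;>
    · refine (pow_le_pow_iff_left₀ (norm_nonneg _) (norm_nonneg _) two_ne_zero).mp ?_
      rw [this]
      nlinarith [sq_nonneg ‖(p : F × F).1‖, sq_nonneg ‖(p : F × F).2‖]
  have hcl : IsClosed (T.range : Set F) :=
    hanti.isClosed_range T.uniformContinuous
  have hc : CompleteSpace T.range := hcl.completeSpace_coe
  have htop : T.range = ⊤ := by
    rw [← Submodule.orthogonal_eq_bot_iff, Submodule.eq_bot_iff]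
    intro w hw
    refine h.eq_zero_of_orthogonal hκ fun x => ?_
    rw [Submodule.mem_orthogonal'] at hw
    exact hw _ ⟨⟨_, mem_closedGraph x⟩, rfl⟩
  have hz : z ∈ T.range := by rw [htop]; trivial
  obtain ⟨p, hp⟩ := hz
  exact ⟨p, p.2, hp⟩

/-- The closure of `B` is skew-adjoint: it contains its negative adjoint. -/
theorem mem_closedGraph_of_forall (h : IsAnalyticSkew D B r) {u v : F}
    (huv : ∀ x : D, ⟪v, (x : F)⟫ = -⟪u, (B x : F)⟫) : (u, v) ∈ closedGraph B := by
  have huv' : ∀ q ∈ closedGraph B, ⟪v, q.1⟫ = -⟪u, q.2⟫ := fun q hq =>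
    closedGraph_induction (P := fun q => ⟪v, q.1⟫ = -⟪u, q.2⟫)
      (isClosed_eq (by fun_prop) (by fun_prop)) huv hq
  -- The difference of `(u, v)` and `p` is of the form `(x, x)`, and `x` is orthogonal to the range
  -- of `B + 1`.
  obtain ⟨p, hp, hpz⟩ := h.exists_mem_closedGraph (κ := -1) (Or.inr rfl) (v - u)
  obtain ⟨q, hq, hqz⟩ := h.exists_mem_closedGraph (κ := 1) (Or.inl rfl) (u - p.1)
  have h1 := huv' q hq
  have h2 := h.inner_closedGraph hp hq
  have e1 : v = p.2 + (u - p.1) := by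
    have : v = p.2 + ((-1 : ℝ) : ℂ) • p.1 + u := by rw [hpz]; abel
    rw [this]
    simp
    abel
  have e2 : u - p.1 = 0 := by
    rw [← inner_self_eq_zero (𝕜 := ℂ)]
    nth_rewrite 2 [← hqz]
    rw [Complex.ofReal_one, one_smul, inner_add_right]
    have e3 : u - p.1 = v - p.2 := by rw [e1]; abel
    have h3 : ⟪u - p.1, q.1⟫ = -⟪u - p.1, q.2⟫ := by
      nth_rewrite 1 [e3]
      rw [inner_sub_left, inner_sub_left, h1, h2]
      ring
    rw [h3, add_neg_cancel]
  have e3 : v = p.2 := by rw [e1, e2, add_zero]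
  rw [sub_eq_zero.mp e2, e3]
  exact hp

theorem hasDerivAt_group (h : IsAnalyticSkew D B r) (x : D) :
    HasDerivAt (fun t : ℝ => (h.group.toFun t : F →L[ℂ] F) x) (B x : F) 0 :=
  h.hasDerivAt_globalExp_zero x

/-- A unitary group whose derivative at `0` is `B` on `D` is generated by the closure of `B`. -/
theorem hasDerivAt_iff (h : IsAnalyticSkew D B r) {U : UnitaryGroup F}
    (hU : ∀ x : D, HasDerivAt (fun t : ℝ => (U.toFun t : F →L[ℂ] F) x) (B x : F) 0) (x y : F) :
    HasDerivAt (fun t : ℝ => (U.toFun t : F →L[ℂ] F) x) y 0 ↔ (x, y) ∈ closedGraph B := by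
  refine ⟨fun hxy => h.mem_closedGraph_of_forall fun z => ?_, fun hxy => ?_⟩
  · exact UnitaryGroup.inner_hasDerivAt hxy (hU z)
  · exact closedGraph_induction
      (P := fun p : F × F => HasDerivAt (fun t : ℝ => (U.toFun t : F →L[ℂ] F) p.1) p.2 0)
      U.isClosed_setOf_hasDerivAt hU hxy

theorem eq_group (h : IsAnalyticSkew D B r) {U : UnitaryGroup F}
    (hU : ∀ x y, HasDerivAt (fun t : ℝ => (U.toFun t : F →L[ℂ] F) x) y 0 ↔
      (x, y) ∈ closedGraph B) : U = h.group :=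
  UnitaryGroup.eq_of_hasDerivAt h.dense
    (fun x y => (hU x y).trans (h.hasDerivAt_iff h.hasDerivAt_group x y).symm)
    fun x hx => ⟨B ⟨x, hx⟩, (hU _ _).mpr (mem_closedGraph ⟨x, hx⟩)⟩

/-- The exponential series of `B + c` converges to `exp (t c) exp (t B)`, as the Cauchy product of
the exponential series of `B` with that of the scalar `c`. -/
theorem hasSum_add_smul_pow (h : IsAnalyticSkew D B r) {t : ℝ} (ht : |t| < r) (c : ℂ) (x : D) :
    HasSum (fun n : ℕ => ((t : ℂ) ^ n / (n.factorial : ℂ)) •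
        (((algebraMap ℂ (Module.End ℂ D) c + B) ^ n) x : F))
      (Complex.exp (t * c) • (h.group.toFun t : F →L[ℂ] F) x) := by
  have ht' : ‖(t : ℂ)‖ < r := by simpa using ht
  have h1 := NormedSpace.expSeries_div_hasSum_exp ((t : ℂ) * c)
  have h2 := NormedSpace.norm_expSeries_div_summable ((t : ℂ) * c)
  rw [← Complex.exp_eq_exp_ℂ] at h1
  have h3 := hasSum_antidiagonal_of_bilinear (E := ℂ) (G := F) (K := F)
    (f := fun p : ℂ × F => p.1 • p.2)
    ((ContinuousLinearMap.lsmul ℝ ℂ : ℂ →L[ℝ] F →L[ℝ] F).isBoundedBilinearMap) h1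
    (h.hasSum_group ht x) h2 (h.summable_norm x ht')
  refine h3.congr_fun fun N => ?_
  rw [(Algebra.commute_algebraMap_left c B).add_pow', LinearMap.sum_apply]
  push_cast
  rw [Finset.smul_sum]
  refine Finset.sum_congr rfl fun p hp => ?_
  obtain rfl := (mem_antidiagonal.mp hp).symm
  rw [← map_pow]
  simp only [LinearMap.smul_apply, Module.End.mul_apply, Module.algebraMap_end_apply,
    Submodule.coe_smul, smul_smul, ← Nat.cast_smul_eq_nsmul ℂ]
  congr 1
  calc _ = t ^ (p.1 + p.2) * c ^ p.1 *
        (((p.1 + p.2).choose p.1 : ℂ) / ((p.1 + p.2).factorial : ℂ)) := by ring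
    _ = _ := by
      rw [choose_div_factorial]
      ring

end IsAnalyticSkew

/-! ### Essential self-adjointness and exponentials -/

theorem unitaryExp_eq {T : F →ₗ.[ℂ] F} (hT : ∃! U : UnitaryGroup F, IsGenerator U T)
    {U : UnitaryGroup F} (hU : IsGenerator U T) : unitaryExp T = (U.toFun 1 : F →L[ℂ] F) := by
  rw [unitaryExp, dif_pos hT.exists, hT.unique hT.exists.choose_spec hU]

namespace IsAnalyticSkew

/-- To check that the closure of `B` generates a unitary group, the vectors of `D` suffice. -/
theorem isGenerator_of_hasDerivAt (h : IsAnalyticSkew D B r) {U : UnitaryGroup F}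
    (hU : ∀ x : D, HasDerivAt (fun t : ℝ => (U.toFun t : F →L[ℂ] F) x) (B x : F) 0) :
    IsGenerator U (toPMap B).closure := fun x y => by
  rw [h.graph_closure, h.hasDerivAt_iff hU]

theorem existsUnique_isGenerator (h : IsAnalyticSkew D B r) :
    ∃! U : UnitaryGroup F, IsGenerator U (toPMap B).closure :=
  ⟨h.group, h.isGenerator_of_hasDerivAt h.hasDerivAt_group, fun U hU =>
    h.eq_group fun x y => by rw [← hU x y, h.graph_closure]⟩

variable {A : D →ₗ[ℂ] D}

/-- The group of the skew-symmetric operator `i A` is generated by `i` times the closure of `A`. -/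
theorem isGenerator_I_smul (h : IsAnalyticSkew D (Complex.I • A) r) :
    IsGenerator h.group (Complex.I • (toPMap A).closure) := fun x y => by
  rw [h.hasDerivAt_iff h.hasDerivAt_group]
  have e : y = Complex.I • (-Complex.I • y) := by
    rw [smul_smul]; simp
  nth_rewrite 2 [e]
  rw [mem_closedGraph_smul_iff A Complex.I_ne_zero, ← h.graph_closure_of_I_smul,
    LinearPMap.mem_graph_iff, LinearPMap.mem_graph_iff]
  constructor
  · rintro ⟨z, hz1, hz2⟩
    refine ⟨z, hz1, ?_⟩
    change Complex.I • (toPMap A).closure z = y at hz2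
    change (toPMap A).closure z = -Complex.I • y
    rw [← hz2, smul_smul]; simp
  · rintro ⟨z, hz1, hz2⟩
    refine ⟨z, hz1, ?_⟩
    change Complex.I • (toPMap A).closure z = y
    change (toPMap A).closure z = -Complex.I • y at hz2
    rw [hz2, smul_smul]; simp

/-- Nelson's analytic vector theorem. -/
theorem isEssentiallySelfAdjoint (h : IsAnalyticSkew D (Complex.I • A) r) :
    IsEssentiallySelfAdjoint (toPMap A) := by
  have hsymm : ∀ x y : D, ⟪(A x : F), (y : F)⟫ = ⟪(x : F), (A y : F)⟫ := by
    intro x y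
    have := h.skew x y
    simp only [LinearMap.smul_apply, Submodule.coe_smul, inner_smul_left, inner_smul_right,
      Complex.conj_I] at this
    refine mul_left_cancel₀ Complex.I_ne_zero ?_
    linear_combination -this
  have hdense : Dense ((toPMap A).closure.domain : Set F) :=
    h.dense.mono (LinearPMap.le_closure (toPMap A)).1
  refine ⟨h.dense, hsymm,
    (isClosable_and_graph_closure h.snd_eq_zero_of_mem_closedGraph_of_I_smul).1, ?_⟩
  rw [LinearPMap.isSelfAdjoint_def]
  refine LinearPMap.eq_of_eq_graph ?_
  rw [LinearPMap.adjoint_graph_eq_graph_adjoint hdense, h.graph_closure_of_I_smul]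
  ext ⟨u, v⟩
  rw [Submodule.mem_adjoint_iff]
  constructor
  · intro H
    rw [← mem_closedGraph_smul_iff A Complex.I_ne_zero]
    refine h.mem_closedGraph_of_forall fun x => ?_
    have h1 : ⟪(A x : F), u⟫ = ⟪(x : F), v⟫ := sub_eq_zero.mp (H _ _ (mem_closedGraph x))
    have h2 : ⟪u, (A x : F)⟫ = ⟪v, (x : F)⟫ := by
      rw [← inner_conj_symm, h1, inner_conj_symm]
    simp only [LinearMap.smul_apply, Submodule.coe_smul, inner_smul_left, inner_smul_right,
      Complex.conj_I, h2]
    ring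
  · intro H a b hab
    rw [← mem_closedGraph_smul_iff A Complex.I_ne_zero] at H hab
    have := h.inner_closedGraph hab H
    simp only [inner_smul_left, inner_smul_right, Complex.conj_I] at this
    refine mul_left_cancel₀ Complex.I_ne_zero ?_
    linear_combination -this

/-- A restriction that still has a dense set of analytic vectors has the same closure. -/
theorem closure_eq_of_restrict {D' : Submodule ℂ F} {A' : D' →ₗ[ℂ] D'}
    (h : IsAnalyticSkew D (Complex.I • A) r) (h' : IsAnalyticSkew D' (Complex.I • A') r)
    (hD : ∀ x : D', ∃ y : D, (y : F) = x ∧ (A y : F) = A' x) :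
    (toPMap A').closure = (toPMap A).closure := by
  refine LinearPMap.eq_of_eq_graph ?_
  rw [h.graph_closure_of_I_smul, h'.graph_closure_of_I_smul]
  ext ⟨u, v⟩
  constructor
  · refine closedGraph_induction (P := fun p : F × F => p ∈ closedGraph A)
      (Submodule.isClosed_topologicalClosure (toPMap A).graph) fun x => ?_
    obtain ⟨y, hy1, hy2⟩ := hD x
    rw [← hy1, ← hy2]
    exact mem_closedGraph y
  · intro H
    rw [← mem_closedGraph_smul_iff _ Complex.I_ne_zero] at H ⊢
    refine h'.mem_closedGraph_of_forall fun x => ?_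
    obtain ⟨y, hy1, hy2⟩ := hD x
    have := h.inner_closedGraph H (mem_closedGraph y)
    simpa [hy1, hy2] using this

end IsAnalyticSkew

end Abstract

variable {H : Type u} [NormedAddCommGroup H] [InnerProductSpace ℂ H]

/-! ### Tensor powers -/

theorem inner_tensorLeft (n : ℕ) (f g : H) (Φ Ψ : TPow H n) :
    ⟪tensorLeft n f Φ, tensorLeft n g Ψ⟫ = ⟪f, g⟫ * ⟪Φ, Ψ⟫ :=
  (UniformSpace.Completion.inner_coe (𝕜 := ℂ) (f ⊗ₜ[ℂ] Φ) (g ⊗ₜ[ℂ] Ψ)).trans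
    (TensorProduct.inner_tmul ℂ f g Φ Ψ)

theorem norm_tensorLeft (n : ℕ) (f : H) (Φ : TPow H n) :
    ‖tensorLeft n f Φ‖ = ‖f‖ * ‖Φ‖ :=
  (UniformSpace.Completion.norm_coe (f ⊗ₜ[ℂ] Φ)).trans (TensorProduct.norm_tmul f Φ)

/-- Continuity in the factor that is kept fixed in the definition of `tensorLeft`. -/
theorem continuous_tensorLeft_left (n : ℕ) (Φ : TPow H n) :
    Continuous fun f : H => tensorLeft n f Φ :=
  UniformSpace.Completion.continuous_coe _ |>.comp
    (((TensorProduct.mkL ℂ H (TPow H n)).flip Φ).continuous)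

theorem inner_tprod (n : ℕ) (f g : Fin n → H) :
    ⟪tprod n f, tprod n g⟫ = ∏ i, ⟪f i, g i⟫ := by
  induction n with
  | zero =>
    change ⟪(EuclideanSpace.single PUnit.unit 1 : EuclideanSpace ℂ PUnit.{u + 1}),
      EuclideanSpace.single PUnit.unit 1⟫ = _
    simp
  | succ n ih =>
    rw [Fin.prod_univ_succ, tprod, tprod, inner_tensorLeft, ih]
    rfl

theorem inner_tprod_symTensor_comp (n : ℕ) (f g : Fin n → H) (σ : Equiv.Perm (Fin n)) :
    ⟪tprod n (fun i => f (σ i)), symTensor n g⟫ = ⟪tprod n f, symTensor n g⟫ := by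
  simp only [symTensor, inner_sum, inner_tprod]
  refine Fintype.sum_equiv (Equiv.mulRight σ⁻¹) _ _ fun τ => ?_
  refine Fintype.prod_equiv σ _ _ fun i => ?_
  simp

theorem symTensor_comp (n : ℕ) (f : Fin n → H) (σ : Equiv.Perm (Fin n)) :
    symTensor n (fun i => f (σ i)) = symTensor n f :=
  Fintype.sum_equiv (Equiv.mulLeft σ) _ _ fun _ => rfl

theorem symVec_comp (n : ℕ) (f : Fin n → H) (σ : Equiv.Perm (Fin n)) :
    symVec n (fun i => f (σ i)) = symVec n f :=
  Subtype.ext (symTensor_comp n f σ)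

/-- A closed subspace of a tensor power that contains the elementary tensors of vectors from a total
set is everything. -/
theorem eq_top_of_tprod_mem {w : Set H} (hw : Dense (Submodule.span ℂ w : Set H)) (n : ℕ)
    (K : Submodule ℂ (TPow H n)) (hK : IsClosed (K : Set (TPow H n)))
    (h : ∀ f : Fin n → H, (∀ i, f i ∈ w) → tprod n f ∈ K) : K = ⊤ := by
  induction n with
  | zero =>
    rw [Submodule.eq_top_iff']
    intro x
    have h0 := h Fin.elim0 (fun i => i.elim0)
    have e : x = (EuclideanSpace.equiv PUnit.{u + 1} ℂ (x : EuclideanSpace ℂ PUnit.{u + 1})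
        PUnit.unit) • tprod 0 (Fin.elim0 : Fin 0 → H) := by
      change (x : EuclideanSpace ℂ PUnit.{u + 1}) =
        (EuclideanSpace.equiv PUnit.{u + 1} ℂ (x : EuclideanSpace ℂ PUnit.{u + 1}) PUnit.unit) •
        (EuclideanSpace.single PUnit.unit 1 : EuclideanSpace ℂ PUnit.{u + 1})
      refine PiLp.ext fun i => ?_
      simp
      rfl
    rw [e]
    exact K.smul_mem _ h0
  | succ n ih =>
    -- Elementary tensors `f ⊗ Φ` are reached in two steps: first `f ∈ w` and `Φ` arbitrary, then
    -- `f` arbitrary as well.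
    have h1 : ∀ f ∈ w, ∀ Φ : TPow H n, tensorLeft n f Φ ∈ K := by
      intro f hf
      have := ih (K.comap (tensorLeft n f).toLinearMap) (hK.preimage (tensorLeft n f).continuous)
        fun g hg => h (Fin.cons f g) fun i => by
          refine Fin.cases ?_ (fun j => ?_) i
          · exact hf
          · exact hg j
      rw [Submodule.eq_top_iff'] at this
      exact this
    have h2 : ∀ (Φ : TPow H n) (f : H), tensorLeft n f Φ ∈ K := by
      intro Φ f
      refine hw.induction (P := fun f => tensorLeft n f Φ ∈ K) (fun f hf => ?_)
        (hK.preimage (continuous_tensorLeft_left n Φ)) f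
      let T : H →ₗ[ℂ] TPow H (n + 1) :=
        (UniformSpace.Completion.toComplL (𝕜 := ℂ) (E := H ⊗[ℂ] TPow H n)).toLinearMap ∘ₗ
          (TensorProduct.mk ℂ H (TPow H n)).flip Φ
      have : Submodule.span ℂ w ≤ K.comap T := Submodule.span_le.mpr fun g hg => h1 g hg Φ
      exact this hf
    rw [Submodule.eq_top_iff']
    intro x
    refine UniformSpace.Completion.induction_on (p := fun x => x ∈ K) x hK fun y => ?_
    induction y using TensorProduct.induction_on with
    | zero => rw [UniformSpace.Completion.coe_zero]; exact K.zero_mem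
    | tmul f Φ => exact h2 Φ f
    | add y z hy hz => rw [UniformSpace.Completion.coe_add]; exact K.add_mem hy hz

/-- Two symmetric tensors agree if they have the same inner products with the symmetrized
elementary tensors. -/
theorem symPow_ext (n : ℕ) {x y : symPow H n}
    (h : ∀ g : Fin n → H, ⟪x, symVec n g⟫ = ⟪y, symVec n g⟫) : x = y := by
  rw [← sub_eq_zero, ← inner_self_eq_zero (𝕜 := ℂ)]
  have : symPow H n ≤ (ℂ ∙ ((x - y : symPow H n) : TPow H n))ᗮ := by
    refine Submodule.topologicalClosure_minimal _ ?_ (Submodule.isClosed_orthogonal _)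
    rw [Submodule.span_le]
    rintro _ ⟨g, rfl⟩
    rw [SetLike.mem_coe, Submodule.mem_orthogonal_singleton_iff_inner_right]
    have := h g
    rw [← sub_eq_zero, ← inner_sub_left] at this
    exact this
  have := this (x - y).2
  rwa [Submodule.mem_orthogonal_singleton_iff_inner_right] at this

/-- Up to the factor `n!`, symmetrization is the orthogonal projection onto the symmetric
tensors. -/
theorem projection_tprod (n : ℕ) (f : Fin n → H) :
    (symPow H n).orthogonalProjectionOnto (tprod n f) =
      ((n.factorial : ℂ)⁻¹) • symVec n f := by
  refine symPow_ext n fun g => ?_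
  have hn : (n.factorial : ℂ) ≠ 0 := by exact_mod_cast n.factorial_ne_zero
  rw [Submodule.inner_orthogonalProjectionOnto_eq_of_mem_right, inner_smul_left]
  change ⟪tprod n f, symTensor n g⟫ = _ * ⟪symTensor n f, symTensor n g⟫
  conv_rhs => rw [symTensor, sum_inner]
  simp_rw [inner_tprod_symTensor_comp]
  rw [Finset.sum_const, Finset.card_univ, Fintype.card_perm, Fintype.card_fin, nsmul_eq_mul]
  simp [hn]

/-- The symmetrized tensors of vectors from a total set are total. -/
theorem symVec_induction {w : Set H} (hw : Dense (Submodule.span ℂ w : Set H)) (n : ℕ)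
    (K : Submodule ℂ (symPow H n)) (hK : IsClosed (K : Set (symPow H n)))
    (h : ∀ f : Fin n → H, (∀ i, f i ∈ w) → symVec n f ∈ K) (x : symPow H n) : x ∈ K := by
  have := eq_top_of_tprod_mem hw n
    (K.comap (symPow H n).orthogonalProjectionOnto.toLinearMap)
    (hK.preimage (symPow H n).orthogonalProjectionOnto.continuous) fun f hf => by
      rw [Submodule.mem_comap]
      change (symPow H n).orthogonalProjectionOnto (tprod n f) ∈ K
      rw [projection_tprod]
      exact K.smul_mem _ (h f hf)
  have hx : (x : TPow H n) ∈ K.comap (symPow H n).orthogonalProjectionOnto.toLinearMap := by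
    rw [this]; trivial
  rw [Submodule.mem_comap] at hx
  change (symPow H n).orthogonalProjectionOnto (x : TPow H n) ∈ K at hx
  rwa [Submodule.orthogonalProjectionOnto_mem_subspace_eq_self] at hx

theorem clm_ext_symVec {n : ℕ} {L L' : symPow H n →L[ℂ] symPow H n}
    (h : ∀ g : Fin n → H, L (symVec n g) = L' (symVec n g)) : L = L' :=
  ContinuousLinearMap.ext fun x =>
    symVec_induction (w := Set.univ) (by rw [Submodule.span_univ]; exact dense_univ) n
      (LinearMap.eqLocus (L : symPow H n →ₗ[ℂ] symPow H n) (L' : symPow H n →ₗ[ℂ] symPow H n))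
      (isClosed_eq L.continuous L'.continuous) (fun g _ => h g) x

/-! ### Creation and annihilation of one particle -/

theorem createN_apply (n : ℕ) (f : H) (Φ : symPow H n) :
    createN n f Φ = ((Real.sqrt (n + 1) : ℝ) : ℂ) •
      (symPow H (n + 1)).orthogonalProjectionOnto (tensorLeft n f (Φ : TPow H n)) := rfl

theorem norm_createN_le (n : ℕ) (f : H) (Φ : symPow H n) :
    ‖createN n f Φ‖ ≤ Real.sqrt (n + 1) * ‖f‖ * ‖Φ‖ := by
  rw [createN_apply, norm_smul, Complex.norm_real, Real.norm_of_nonneg (Real.sqrt_nonneg _),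
    mul_assoc]
  gcongr
  refine (Submodule.norm_orthogonalProjectionOnto_apply_le _ _).trans ?_
  rw [norm_tensorLeft]
  rfl

theorem norm_annihN_le (n : ℕ) (f : H) (Φ : symPow H (n + 1)) :
    ‖annihN n f Φ‖ ≤ Real.sqrt (n + 1) * ‖f‖ * ‖Φ‖ := by
  refine (ContinuousLinearMap.le_opNorm _ _).trans ?_
  gcongr
  rw [annihN, LinearIsometryEquiv.norm_map]
  exact ContinuousLinearMap.opNorm_le_bound _ (by positivity) (norm_createN_le n f)

theorem sqrt_mul_factorial (n : ℕ) :
    Real.sqrt (n + 1) * (((n + 1).factorial : ℝ)⁻¹ * n.factorial) = (Real.sqrt (n + 1))⁻¹ := by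
  have h0 : (0 : ℝ) < n + 1 := by positivity
  have h1 : (n.factorial : ℝ) ≠ 0 := by exact_mod_cast n.factorial_ne_zero
  have h2 := Real.mul_self_sqrt h0.le
  have h3 : Real.sqrt (n + 1) ≠ 0 := (Real.sqrt_pos.mpr h0).ne'
  rw [Nat.factorial_succ]
  push_cast
  rw [eq_comm, inv_eq_iff_eq_inv, eq_comm]
  field_simp
  linarith

/-- In terms of the unnormalized symmetrized tensors, `a*(f)` adds the factor `f`. -/
theorem createN_symVec (n : ℕ) (f : H) (g : Fin n → H) :
    createN n f (symVec n g) =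
      (((Real.sqrt (n + 1))⁻¹ : ℝ) : ℂ) • symVec (n + 1) (Fin.cons f g : Fin (n + 1) → H) := by
  have h1 : tensorLeft n f (symTensor n g) = ∑ σ : Equiv.Perm (Fin n),
      tprod (n + 1) (Fin.cons f fun i => g (σ i) : Fin (n + 1) → H) := by
    rw [symTensor, map_sum]
    rfl
  have h2 : ∀ σ : Equiv.Perm (Fin n),
      symVec (n + 1) (Fin.cons f fun i => g (σ i) : Fin (n + 1) → H) =
        symVec (n + 1) (Fin.cons f g : Fin (n + 1) → H) := by
    intro σ
    rw [← symVec_comp (n + 1) (Fin.cons f g : Fin (n + 1) → H)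
      (Equiv.Perm.decomposeFin.symm (0, σ))]
    congr 1
    funext i
    refine Fin.cases ?_ (fun j => ?_) i
    · simp
    · simp
  rw [createN_apply]
  change _ • (symPow H (n + 1)).orthogonalProjectionOnto (tensorLeft n f (symTensor n g)) = _
  rw [h1, map_sum]
  simp_rw [projection_tprod, h2]
  rw [Finset.sum_const, Finset.card_univ, Fintype.card_perm, Fintype.card_fin,
    ← Nat.cast_smul_eq_nsmul ℂ, smul_smul, smul_smul]
  congr 1
  rw [← sqrt_mul_factorial]
  push_cast
  ring

/-- In terms of the unnormalized symmetrized tensors, `a(f)` contracts `f` with each factor in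
turn. The remaining factors are listed by moving the `0`-th one to the place of the one removed, as
`Equiv.Perm.decomposeFin` does; their order is irrelevant. -/
theorem annihN_symVec (n : ℕ) (f : H) (g : Fin (n + 1) → H) :
    annihN n f (symVec (n + 1) g) = ((Real.sqrt (n + 1) : ℝ) : ℂ) •
      ∑ p : Fin (n + 1), ⟪f, g p⟫ • symVec n (fun i => g (Equiv.swap 0 p i.succ)) := by
  refine ext_inner_right ℂ fun Φ => ?_
  rw [annihN, ContinuousLinearMap.adjoint_inner_left, createN_apply, inner_smul_right,
    Submodule.inner_orthogonalProjectionOnto_eq_of_mem_left, inner_smul_left, Complex.conj_ofReal,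
    sum_inner]
  congr 1
  change ⟪symTensor (n + 1) g, _⟫ = _
  rw [symTensor, sum_inner, ← Equiv.sum_comp Equiv.Perm.decomposeFin.symm, Fintype.sum_prod_type]
  refine Finset.sum_congr rfl fun p _ => ?_
  rw [inner_smul_left, inner_conj_symm]
  change (_ : ℂ) = _ * ⟪symTensor n (fun i => g (Equiv.swap 0 p i.succ)), (Φ : TPow H n)⟫
  rw [symTensor, sum_inner, Finset.mul_sum]
  refine Finset.sum_congr rfl fun e _ => ?_
  rw [tprod, inner_tensorLeft, Equiv.Perm.decomposeFin_symm_apply_zero]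
  congr 2
  congr 1
  funext i
  rw [Fin.tail, Equiv.Perm.decomposeFin_symm_apply_succ]

/-- The canonical commutation relations on the vacuum sector. -/
theorem annihN_zero_createN_zero (f k : H) (Φ : symPow H 0) :
    annihN 0 f (createN 0 k Φ) = ⟪f, k⟫ • Φ := by
  have : (annihN 0 f).comp (createN 0 k) = ⟪f, k⟫ • ContinuousLinearMap.id ℂ _ := by
    refine clm_ext_symVec fun h => ?_
    change annihN 0 f (createN 0 k (symVec 0 h)) = ⟪f, k⟫ • symVec 0 h
    rw [createN_symVec, map_smul, annihN_symVec, Fin.sum_univ_succ]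
    simp
  exact congrArg (fun L : symPow H 0 →L[ℂ] symPow H 0 => L Φ) this

/-- Two ways to replace the `q`-th entry of `h` by `k`: to put `k` in front and then swap it with
the entry of `h` before dropping the `0`-th place, and to swap the `q`-th entry with the `0`-th one,
replace it by `k`, and swap back. -/
theorem cons_swap_succ {X : Type*} {n : ℕ} (k : X) (h : Fin (n + 1) → X) (q i : Fin (n + 1)) :
    (Fin.cons k h : Fin (n + 2) → X) (Equiv.swap 0 q.succ i.succ) =
      (Fin.cons k fun j => h (Equiv.swap 0 q j.succ) : Fin (n + 1) → X) (Equiv.swap 0 q i) := by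
  rcases eq_or_ne i q with rfl | hiq
  · simp
  · rw [Equiv.swap_apply_of_ne_of_ne (Fin.succ_ne_zero _) ((Fin.succ_injective _).ne hiq),
      Fin.cons_succ]
    refine Fin.cases (motive := fun i => i ≠ q → h i =
      (Fin.cons k fun j => h (Equiv.swap 0 q j.succ) : Fin (n + 1) → X) (Equiv.swap 0 q i))
      (fun h0 => ?_) (fun j hj => ?_) i hiq
    · obtain ⟨m, rfl⟩ := Fin.exists_succ_eq.mpr h0.symm
      simp
    · rw [Equiv.swap_apply_of_ne_of_ne (Fin.succ_ne_zero _) hj, Fin.cons_succ,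
        Equiv.swap_apply_of_ne_of_ne (Fin.succ_ne_zero _) hj]

/-- The canonical commutation relations on the sectors with at least one particle. -/
theorem annihN_succ_createN_succ (n : ℕ) (f k : H) (Φ : symPow H (n + 1)) :
    annihN (n + 1) f (createN (n + 1) k Φ) =
      createN n k (annihN n f Φ) + ⟪f, k⟫ • Φ := by
  have : (annihN (n + 1) f).comp (createN (n + 1) k) =
      (createN n k).comp (annihN n f) + ⟪f, k⟫ • ContinuousLinearMap.id ℂ _ := by
    refine clm_ext_symVec fun h => ?_
    change annihN (n + 1) f (createN (n + 1) k (symVec (n + 1) h)) =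
      createN n k (annihN n f (symVec (n + 1) h)) + ⟪f, k⟫ • symVec (n + 1) h
    have hs : ∀ m : ℕ, ((Real.sqrt (m + 1) : ℝ) : ℂ) ≠ 0 := fun m => by
      have : 0 < Real.sqrt ((m : ℝ) + 1) := Real.sqrt_pos.mpr (by positivity)
      exact_mod_cast this.ne'
    rw [createN_symVec, map_smul, annihN_symVec, annihN_symVec, map_smul, map_sum, smul_smul,
      Complex.ofReal_inv, inv_mul_cancel₀ (hs _), one_smul, Fin.sum_univ_succ]
    refine (add_comm _ _).trans ?_
    simp_rw [map_smul, createN_symVec]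
    congr 1
    · rw [Finset.smul_sum]
      refine Finset.sum_congr rfl fun q _ => ?_
      rw [smul_comm, smul_smul _ _ (symVec _ _), Complex.ofReal_inv, mul_inv_cancel₀ (hs _),
        one_smul, Fin.cons_succ, ← symVec_comp (n + 1)
          (Fin.cons k fun i => h (Equiv.swap 0 q i.succ) : Fin (n + 1) → H) (Equiv.swap 0 q)]
      congr 2
      funext i
      exact cons_swap_succ k h q i
  exact congrArg (fun L : symPow H (n + 1) →L[ℂ] symPow H (n + 1) => L Φ) this

/-! ### Operators on the finite particle vectors -/

theorem create_apply_zero (f : H) (x : finiteParticle H) : (create f x : Fock H) 0 = 0 := rfl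

theorem create_apply_succ (f : H) (x : finiteParticle H) (n : ℕ) :
    (create f x : Fock H) (n + 1) = createN n f ((x : Fock H) n) := rfl

theorem annih_apply (f : H) (x : finiteParticle H) (n : ℕ) :
    (annih f x : Fock H) n = annihN n f ((x : Fock H) (n + 1)) := rfl

/-- The annihilation and creation operators are formal adjoints of each other. -/
theorem inner_annih (f : H) (x y : finiteParticle H) :
    ⟪(annih f x : Fock H), (y : Fock H)⟫ = ⟪(x : Fock H), (create f y : Fock H)⟫ := by
  have h1 := lp.hasSum_inner (𝕜 := ℂ) (annih f x : Fock H) (y : Fock H)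
  have h2 := lp.hasSum_inner (𝕜 := ℂ) (x : Fock H) (create f y : Fock H)
  rw [← hasSum_nat_add_iff' 1] at h2
  simp only [Finset.range_one, Finset.sum_singleton, create_apply_zero, inner_zero_right,
    sub_zero] at h2
  refine h1.unique (h2.congr_fun fun n => ?_)
  rw [create_apply_succ, annih_apply, annihN, ContinuousLinearMap.adjoint_inner_left]

theorem inner_create (f : H) (x y : finiteParticle H) :
    ⟪(create f x : Fock H), (y : Fock H)⟫ = ⟪(x : Fock H), (annih f y : Fock H)⟫ := by
  rw [← inner_conj_symm, ← inner_annih, inner_conj_symm]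

/-- The canonical commutation relations on the finite particle vectors. -/
theorem annih_mul_create (f g : H) :
    (annih f * create g : Module.End ℂ (finiteParticle H)) =
      create g * annih f + ⟪f, g⟫ • (1 : Module.End ℂ (finiteParticle H)) := by
  refine LinearMap.ext fun x => Subtype.ext (lp.ext (funext fun n => ?_))
  change annihN n f (createN n g ((x : Fock H) n)) =
    (create g (annih f x) : Fock H) n + ⟪f, g⟫ • (x : Fock H) n
  cases n with
  | zero => rw [annihN_zero_createN_zero, create_apply_zero, zero_add]
  | succ n => rw [annihN_succ_createN_succ, create_apply_succ, annih_apply]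

theorem hasSum_norm_sq (Φ : Fock H) : HasSum (fun n => ‖Φ n‖ ^ 2) (‖Φ‖ ^ 2) := by
  simpa using lp.hasSum_norm (p := 2) (by simp) Φ

/-- The components of `x` with `N` or more particles vanish. -/
def VanishesFrom (N : ℕ) (x : finiteParticle H) : Prop :=
  ∀ n, N ≤ n → (x : Fock H) n = 0

theorem VanishesFrom.mono {N M : ℕ} {x : finiteParticle H} (h : VanishesFrom N x) (hNM : N ≤ M) :
    VanishesFrom M x := fun n hn => h n (hNM.trans hn)

theorem VanishesFrom.sub {N : ℕ} {x y : finiteParticle H} (hx : VanishesFrom N x)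
    (hy : VanishesFrom N y) : VanishesFrom N (x - y) := fun n hn => by
  change (x : Fock H) n - (y : Fock H) n = 0
  rw [hx n hn, hy n hn, sub_zero]

theorem VanishesFrom.smul {N : ℕ} {x : finiteParticle H} (hx : VanishesFrom N x) (c : ℂ) :
    VanishesFrom N (c • x) := fun n hn => by
  change c • (x : Fock H) n = 0
  rw [hx n hn, smul_zero]

theorem VanishesFrom.create {N : ℕ} {x : finiteParticle H} (h : VanishesFrom N x) (f : H) :
    VanishesFrom (N + 1) (create f x) := fun n hn => by
  cases n with
  | zero => rfl
  | succ n => rw [create_apply_succ, h n (by omega), map_zero]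

theorem VanishesFrom.annih {N : ℕ} {x : finiteParticle H} (h : VanishesFrom N x) (f : H) :
    VanishesFrom N (annih f x) := fun n hn => by
  rw [annih_apply, h (n + 1) (by omega), map_zero]

theorem norm_create_le {N : ℕ} {x : finiteParticle H} (h : VanishesFrom N x) (f : H) :
    ‖(create f x : Fock H)‖ ≤ Real.sqrt N * ‖f‖ * ‖(x : Fock H)‖ := by
  refine (pow_le_pow_iff_left₀ (norm_nonneg _) (by positivity) two_ne_zero).mp ?_
  rw [mul_pow]
  have h1 := hasSum_norm_sq (create f x : Fock H)
  rw [← hasSum_nat_add_iff' 1] at h1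
  simp only [Finset.range_one, Finset.sum_singleton, create_apply_zero, norm_zero, ne_eq,
    OfNat.ofNat_ne_zero, not_false_eq_true, zero_pow, sub_zero] at h1
  refine hasSum_le (fun n => ?_) h1
    ((hasSum_norm_sq (x : Fock H)).mul_left ((Real.sqrt N * ‖f‖) ^ 2))
  rw [← mul_pow, create_apply_succ]
  gcongr
  rcases lt_or_ge n N with hn | hn
  · refine (norm_createN_le n f _).trans ?_
    gcongr
    exact_mod_cast hn
  · rw [h n hn, map_zero, norm_zero, norm_zero, mul_zero]

theorem norm_annih_le {N : ℕ} {x : finiteParticle H} (h : VanishesFrom N x) (f : H) :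
    ‖(annih f x : Fock H)‖ ≤ Real.sqrt N * ‖f‖ * ‖(x : Fock H)‖ := by
  refine (pow_le_pow_iff_left₀ (norm_nonneg _) (by positivity) two_ne_zero).mp ?_
  rw [mul_pow]
  have h1 := hasSum_norm_sq (x : Fock H)
  rw [← hasSum_nat_add_iff' 1] at h1
  simp only [Finset.range_one, Finset.sum_singleton] at h1
  calc ‖(annih f x : Fock H)‖ ^ 2
      ≤ (Real.sqrt N * ‖f‖) ^ 2 * (‖(x : Fock H)‖ ^ 2 - ‖(x : Fock H) 0‖ ^ 2) := by
        refine hasSum_le (fun n => ?_) (hasSum_norm_sq (annih f x : Fock H)) (h1.mul_left _)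
        rw [← mul_pow, annih_apply]
        gcongr
        rcases lt_or_ge n N with hn | hn
        · refine (norm_annihN_le n f _).trans ?_
          gcongr
          exact_mod_cast hn
        · rw [h (n + 1) (by omega), map_zero, norm_zero, norm_zero, mul_zero]
    _ ≤ (Real.sqrt N * ‖f‖) ^ 2 * ‖(x : Fock H)‖ ^ 2 := by
        gcongr
        exact sub_le_self _ (sq_nonneg _)

/-! ### Dense subspaces of the Fock space -/

theorem basisSpan_le (w : Set H) : basisSpan w ≤ finiteParticle H := by
  refine Submodule.span_le.mpr ?_
  rintro _ ⟨n, f, -, rfl⟩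
  exact ⟨n + 1, fun m hm => lp.single_apply_ne 2 n _ (by omega)⟩

/-- The Fock basis vectors of a total set of vectors are total in the Fock space. -/
theorem dense_basisSpan {w : Set H} (hw : Dense (Submodule.span ℂ w : Set H)) :
    Dense (basisSpan w : Set (Fock H)) := by
  have h1 : ∀ (n : ℕ) (v : symPow H n), lp.single 2 n v ∈ (basisSpan w).topologicalClosure := by
    intro n v
    refine symVec_induction hw n ((basisSpan w).topologicalClosure.comap
      (lp.singleContinuousLinearMap ℂ (fun n => symPow H n) 2 n).toLinearMap)
      ((Submodule.isClosed_topologicalClosure _).preimage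
        (lp.singleContinuousLinearMap ℂ (fun n => symPow H n) 2 n).continuous)
      (fun f hf => ?_) v
    exact Submodule.le_topologicalClosure _ (Submodule.subset_span ⟨n, f, hf, rfl⟩)
  intro Φ
  refine (Submodule.isClosed_topologicalClosure (basisSpan w)).mem_of_tendsto
    (lp.hasSum_single (by simp) Φ) (Eventually.of_forall fun s => ?_)
  exact Submodule.sum_mem _ fun n _ => h1 n _

theorem dense_finiteParticle : Dense (finiteParticle H : Set (Fock H)) :=
  (dense_basisSpan (w := Set.univ) (by rw [Submodule.span_univ]; exact dense_univ)).mono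
    (basisSpan_le _)

theorem single_mem_finiteParticle (n : ℕ) (v : symPow H n) :
    (lp.single 2 n v : Fock H) ∈ finiteParticle H :=
  ⟨n + 1, fun _ hm => lp.single_apply_ne 2 n _ (by omega)⟩

theorem create_single (f : H) (n : ℕ) (v : symPow H n) :
    (create f ⟨lp.single 2 n v, single_mem_finiteParticle n v⟩ : Fock H) =
      lp.single 2 (n + 1) (createN n f v) := by
  refine lp.ext (funext fun m => ?_)
  cases m with
  | zero => rw [create_apply_zero, lp.single_apply_ne 2 _ _ (by omega)]
  | succ m =>
    rw [create_apply_succ]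
    change createN m f ((lp.single 2 n v : Fock H) m) = _
    by_cases h : m = n
    · subst h
      rw [lp.single_apply_self, lp.single_apply_self]
    · rw [lp.single_apply_ne 2 _ _ h, lp.single_apply_ne 2 _ _ (by omega), map_zero]

theorem annih_single_zero (f : H) (v : symPow H 0) :
    (annih f ⟨lp.single 2 0 v, single_mem_finiteParticle 0 v⟩ : Fock H) = 0 := by
  refine lp.ext (funext fun m => ?_)
  rw [annih_apply]
  change annihN m f ((lp.single 2 0 v : Fock H) (m + 1)) = _
  rw [lp.single_apply_ne 2 _ _ (by omega), map_zero]
  rfl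

theorem annih_single_succ (f : H) (n : ℕ) (v : symPow H (n + 1)) :
    (annih f ⟨lp.single 2 (n + 1) v, single_mem_finiteParticle (n + 1) v⟩ : Fock H) =
      lp.single 2 n (annihN n f v) := by
  refine lp.ext (funext fun m => ?_)
  rw [annih_apply]
  change annihN m f ((lp.single 2 (n + 1) v : Fock H) (m + 1)) = _
  by_cases h : m = n
  · subst h
    rw [lp.single_apply_self, lp.single_apply_self]
  · rw [lp.single_apply_ne 2 _ _ h, lp.single_apply_ne 2 _ _ (by omega), map_zero]

/-- Invariance of the span of the Fock basis vectors need only be checked on these vectors. -/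
theorem map_mem_basisSpan {w : Set H} (T : finiteParticle H →ₗ[ℂ] finiteParticle H)
    (h : ∀ (n : ℕ) (f : Fin n → H), (∀ i, f i ∈ w) →
      (T ⟨lp.single 2 n (symVec n f), single_mem_finiteParticle n _⟩ : Fock H) ∈ basisSpan w)
    (x : finiteParticle H) (hx : (x : Fock H) ∈ basisSpan w) : (T x : Fock H) ∈ basisSpan w := by
  have h1 : basisSpan w ≤ (((basisSpan w).comap (finiteParticle H).subtype).comap T).map
      (finiteParticle H).subtype := by
    refine Submodule.span_le.mpr ?_
    rintro _ ⟨n, f, hf, rfl⟩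
    exact ⟨⟨_, single_mem_finiteParticle n _⟩, h n f hf, rfl⟩
  obtain ⟨y, hy, hyx⟩ := h1 hx
  obtain rfl : y = x := Subtype.ext hyx
  exact hy

theorem single_symVec_mem {w : Set H} {n : ℕ} {f : Fin n → H} (hf : ∀ i, f i ∈ w) (c : ℂ) :
    (lp.single 2 n (c • symVec n f) : Fock H) ∈ basisSpan w := by
  rw [lp.single_smul]
  exact Submodule.smul_mem _ _ (Submodule.subset_span ⟨n, f, hf, rfl⟩)

theorem create_mem_basisSpan {w : Set H} {ψ : H} (hψ : ψ ∈ w) (x : finiteParticle H)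
    (hx : (x : Fock H) ∈ basisSpan w) : (create ψ x : Fock H) ∈ basisSpan w := by
  refine map_mem_basisSpan (create ψ) (fun n f hf => ?_) x hx
  rw [create_single, createN_symVec]
  exact single_symVec_mem (fun i => by
    refine Fin.cases ?_ (fun j => ?_) i
    · exact hψ
    · exact hf j) _

theorem annih_mem_basisSpan {w : Set H} (ψ : H) (x : finiteParticle H)
    (hx : (x : Fock H) ∈ basisSpan w) : (annih ψ x : Fock H) ∈ basisSpan w := by
  refine map_mem_basisSpan (annih ψ) (fun n f hf => ?_) x hx
  cases n with
  | zero => rw [annih_single_zero]; exact Submodule.zero_mem _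
  | succ n =>
    rw [annih_single_succ, annihN_symVec, Finset.smul_sum]
    change lp.lsingle (𝕜 := ℂ) (E := fun n => symPow H n) 2 n _ ∈ _
    rw [map_sum]
    refine Submodule.sum_mem _ fun p _ => ?_
    rw [smul_smul]
    exact single_symVec_mem (fun i => hf _) _

/-! ### The field operators and the squeeze operator -/

/-- All vectors with finitely many particles are analytic for the field operator. They are even
entire; the radius given here is what the crude bound `√N ≤ N` yields. -/
theorem isAnalyticSkew_field (f : H) :
    IsAnalyticSkew (finiteParticle H) (annih f - create f) (1 / (2 * ‖f‖ + 1)) where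
  dense := dense_finiteParticle
  skew x y := by
    simp only [LinearMap.sub_apply, Submodule.coe_sub, inner_sub_left, inner_sub_right,
      inner_annih, inner_create]
    ring
  pos := by positivity
  summable x t ht := by
    obtain ⟨N, hN⟩ := x.2
    have hv : ∀ n : ℕ, VanishesFrom (N + n) (((annih f - create f) ^ n) x) := by
      intro n
      induction n with
      | zero => exact hN
      | succ n ih =>
        rw [pow_succ', Module.End.mul_apply, LinearMap.sub_apply]
        exact ((ih.annih f).mono (Nat.le_succ _)).sub (ih.create f)
    refine summable_of_norm_pow_succ_le (a := 2 * ‖f‖ * N) (by positivity) (fun n => ?_) ht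
    rw [pow_succ', Module.End.mul_apply, LinearMap.sub_apply, Submodule.coe_sub]
    generalize hy : ((annih f - create f) ^ n) x = y at *
    have hvn : VanishesFrom (N + n) y := hy ▸ hv n
    have hsqrt : Real.sqrt ((N + n : ℕ) : ℝ) ≤ N + n := by
      rw [Real.sqrt_le_left (by positivity)]
      exact_mod_cast Nat.le_self_pow two_ne_zero (N + n)
    calc _ ≤ Real.sqrt (N + n : ℕ) * ‖f‖ * ‖(y : Fock H)‖ +
          Real.sqrt (N + n : ℕ) * ‖f‖ * ‖(y : Fock H)‖ :=
          (norm_sub_le _ _).trans (add_le_add (norm_annih_le hvn f) (norm_create_le hvn f))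
      _ = 2 * ‖f‖ * Real.sqrt (N + n : ℕ) * ‖(y : Fock H)‖ := by ring
      _ ≤ 2 * ‖f‖ * (N + n) * ‖(y : Fock H)‖ := by gcongr
      _ ≤ _ := by
        gcongr
        nlinarith [(Nat.cast_nonneg n : (0 : ℝ) ≤ n)]

/-- The squeeze operator as a linear map on the finite particle vectors. -/
def squeezeMap (ψ : H) : finiteParticle H →ₗ[ℂ] finiteParticle H :=
  (Complex.I / 2) • (annih ψ ∘ₗ annih ψ - create ψ ∘ₗ create ψ)

theorem I_smul_squeezeMap_apply (ψ : H) (x : finiteParticle H) :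
    (Complex.I • squeezeMap ψ) x =
      (1 / 2 : ℂ) • (create ψ (create ψ x) - annih ψ (annih ψ x)) := by
  rw [squeezeMap, smul_smul, LinearMap.smul_apply, LinearMap.sub_apply, LinearMap.comp_apply,
    LinearMap.comp_apply, ← neg_sub (create ψ (create ψ x)), smul_neg, ← neg_smul]
  congr 1
  linear_combination (-1 / 2 : ℂ) * Complex.I_mul_I

/-- The skew-symmetric operator `(a*(ψ)² - a(ψ)²) / 2` has norm at most `M + 1` on vectors with
fewer than `M` particles and adds at most two particles, whence the radius `1/2`. -/
theorem isAnalyticSkew_squeeze {ψ : H} (hψ : ‖ψ‖ = 1) :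
    IsAnalyticSkew (finiteParticle H) (Complex.I • squeezeMap ψ) (1 / 2) where
  dense := dense_finiteParticle
  skew x y := by
    rw [I_smul_squeezeMap_apply, I_smul_squeezeMap_apply]
    simp only [Submodule.coe_sub, Submodule.coe_smul, inner_smul_left, inner_smul_right,
      inner_sub_left, inner_sub_right, inner_annih, inner_create]
    rw [map_div₀, map_one, map_ofNat]
    ring
  pos := by norm_num
  summable x t ht := by
    obtain ⟨N, hN⟩ := x.2
    have hv : ∀ n : ℕ, VanishesFrom (N + 2 * n) (((Complex.I • squeezeMap ψ) ^ n) x) := by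
      intro n
      induction n with
      | zero => exact hN
      | succ n ih =>
        rw [pow_succ', Module.End.mul_apply, I_smul_squeezeMap_apply]
        exact ((((ih.create ψ).create ψ).mono (by omega)).sub
          (((ih.annih ψ).annih ψ).mono (by omega))).smul _
    refine summable_of_norm_pow_succ_le (a := N + 1) two_pos (fun n => ?_) ht
    rw [pow_succ', Module.End.mul_apply, I_smul_squeezeMap_apply, Submodule.coe_smul,
      Submodule.coe_sub, norm_smul]
    generalize hy : ((Complex.I • squeezeMap ψ) ^ n) x = y at *
    have hvn : VanishesFrom (N + 2 * n) y := hy ▸ hv n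
    set M := N + 2 * n with hM
    have h1 : ‖(create ψ (create ψ y) : Fock H)‖ ≤ (M + 1) * ‖(y : Fock H)‖ := by
      have h2 := norm_create_le (hvn.create ψ) ψ
      have h3 := norm_create_le hvn ψ
      rw [hψ, mul_one] at h2 h3
      calc _ ≤ Real.sqrt (M + 1 : ℕ) * (Real.sqrt M * ‖(y : Fock H)‖) :=
            h2.trans (by gcongr)
        _ ≤ Real.sqrt (M + 1 : ℕ) * (Real.sqrt (M + 1 : ℕ) * ‖(y : Fock H)‖) := by
            gcongr; omega
        _ = _ := by
            rw [← mul_assoc, Real.mul_self_sqrt (by positivity)]; push_cast; rfl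
    have h1' : ‖(annih ψ (annih ψ y) : Fock H)‖ ≤ (M + 1) * ‖(y : Fock H)‖ := by
      have h2 := norm_annih_le (hvn.annih ψ) ψ
      have h3 := norm_annih_le hvn ψ
      rw [hψ, mul_one] at h2 h3
      calc _ ≤ Real.sqrt M * (Real.sqrt M * ‖(y : Fock H)‖) := h2.trans (by gcongr)
        _ = M * ‖(y : Fock H)‖ := by rw [← mul_assoc, Real.mul_self_sqrt (by positivity)]
        _ ≤ _ := by gcongr; linarith
    have h4 : (M : ℝ) = N + 2 * n := by rw [hM]; push_cast; ring
    have h5 : ‖(1 / 2 : ℂ)‖ = 1 / 2 := by simp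
    rw [h5]
    calc _ ≤ 1 / 2 * ((M + 1) * ‖(y : Fock H)‖ + (M + 1) * ‖(y : Fock H)‖) := by
          gcongr
          exact (norm_sub_le _ _).trans (add_le_add h1 h1')
      _ = _ := by rw [h4]; ring

/-- The commutation relation `[B, P] = P` for `P = a(ψ) - a*(ψ)` and
`B = (a*(ψ)² - a(ψ)²) / 2`. -/
theorem field_mul_squeeze {ψ : H} (hψ : ‖ψ‖ = 1) :
    ((annih ψ - create ψ) * (Complex.I • squeezeMap ψ) : Module.End ℂ (finiteParticle H)) =
      (algebraMap ℂ _ (-1) + Complex.I • squeezeMap ψ) * (annih ψ - create ψ) := by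
  have hB : (Complex.I • squeezeMap ψ : Module.End ℂ (finiteParticle H)) =
      (1 / 2 : ℂ) • (create ψ * create ψ - annih ψ * annih ψ) :=
    LinearMap.ext (I_smul_squeezeMap_apply ψ)
  have h := annih_mul_create ψ ψ
  rw [inner_self_eq_norm_sq_to_K, hψ] at h
  simp only [RCLike.ofReal_one, one_pow, one_smul] at h
  rw [hB]
  set c : Module.End ℂ (finiteParticle H) := create ψ
  set a : Module.End ℂ (finiteParticle H) := annih ψ
  -- Normal ordering of the two products for which `simp` needs the commutation relation.
  have h1 : a * (c * c) = c * (c * a) + (2 : ℂ) • c := by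
    rw [← mul_assoc, h, add_mul, mul_assoc, h, mul_add, mul_one, one_mul, two_smul, add_assoc]
  have h2 : a * (a * c) = c * (a * a) + (2 : ℂ) • a := by
    rw [h, mul_add, mul_one, ← mul_assoc, h, add_mul, one_mul, two_smul, mul_assoc, add_assoc]
  rw [add_mul, ← Algebra.smul_def, mul_smul_comm, smul_mul_assoc]
  simp only [sub_mul, mul_sub, mul_assoc, h1, h2]
  module

/-! ### The squeeze operator on a basis -/

/-- The restriction of the squeeze operator to the span of the Fock basis vectors. -/
def squeezeBasis {w : Set H} {ψ : H} (hψ : ψ ∈ w) : basisSpan w →ₗ[ℂ] basisSpan w :=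
  LinearMap.codRestrict (basisSpan w)
    ((finiteParticle H).subtype ∘ₗ squeezeMap ψ ∘ₗ Submodule.inclusion (basisSpan_le w)) fun x => by
      have hx : ((Submodule.inclusion (basisSpan_le w) x : finiteParticle H) : Fock H) ∈
        basisSpan w := x.2
      exact Submodule.smul_mem _ _ (Submodule.sub_mem _
        (annih_mem_basisSpan ψ _ (annih_mem_basisSpan ψ _ hx))
        (create_mem_basisSpan hψ _ (create_mem_basisSpan hψ _ hx)))

theorem domRestrict_squeeze {w : Set H} {ψ : H} (hψ : ψ ∈ w) :
    (squeeze ψ).domRestrict (basisSpan w) = toPMap (squeezeBasis hψ) := by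
  refine LinearPMap.ext (inf_eq_left.mpr (basisSpan_le w)) fun x h1 h2 => ?_
  rfl

theorem isAnalyticSkew_squeezeBasis {w : Set H} (hw : Dense (Submodule.span ℂ w : Set H)) {ψ : H}
    (hψ : ψ ∈ w) (hψ1 : ‖ψ‖ = 1) :
    IsAnalyticSkew (basisSpan w) (Complex.I • squeezeBasis hψ) (1 / 2) :=
  (isAnalyticSkew_squeeze hψ1).restrict (basisSpan_le w) (dense_basisSpan hw) fun _ => rfl

/-! ### Conjugation of the Weyl operators -/

/-- For small `t`, the relation `P exp (t B) = exp (-t) exp (t B) P` between the group of the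
squeeze operator and the closure of `P = a(ψ) - a*(ψ)`, in terms of the closed graph of `P`. -/
theorem group_mem_closedGraph_of_lt {ψ : H} (hψ : ‖ψ‖ = 1) {t : ℝ} (ht : |t| < 1 / 2)
    {p : Fock H × Fock H} (hp : p ∈ closedGraph (annih ψ - create ψ)) :
    (((isAnalyticSkew_squeeze hψ).group.toFun t : Fock H →L[ℂ] Fock H) p.1,
      Complex.exp (-t) • ((isAnalyticSkew_squeeze hψ).group.toFun t : Fock H →L[ℂ] Fock H) p.2) ∈
      closedGraph (annih ψ - create ψ) := by
  set hS := isAnalyticSkew_squeeze hψ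
  have hcl : IsClosed (closedGraph (annih ψ - create ψ) : Set (Fock H × Fock H)) :=
    Submodule.isClosed_topologicalClosure _
  refine closedGraph_induction (P := fun p : Fock H × Fock H =>
    ((hS.group.toFun t : Fock H →L[ℂ] Fock H) p.1,
      Complex.exp (-t) • (hS.group.toFun t : Fock H →L[ℂ] Fock H) p.2) ∈
      closedGraph (annih ψ - create ψ)) (hcl.preimage (f := fun p : Fock H × Fock H =>
    ((hS.group.toFun t : Fock H →L[ℂ] Fock H) p.1,
      Complex.exp (-t) • (hS.group.toFun t : Fock H →L[ℂ] Fock H) p.2)) (by fun_prop))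
    (fun x => ?_) hp
  -- Both series converge along partial sums that belong to the graph, since `P Bⁿ = (B - 1)ⁿ P`.
  have h1 := hS.hasSum_group ht x
  have h2 := hS.hasSum_add_smul_pow ht (-1) ((annih ψ - create ψ) x)
  rw [mul_neg_one] at h2
  refine hcl.mem_of_tendsto (h1.prodMk h2) (Eventually.of_forall fun s => ?_)
  refine Submodule.sum_mem _ fun n _ => ?_
  have h3 : (annih ψ - create ψ) (((Complex.I • squeezeMap ψ) ^ n) x) =
      ((algebraMap ℂ (Module.End ℂ (finiteParticle H)) (-1) + Complex.I • squeezeMap ψ) ^ n)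
        ((annih ψ - create ψ) x) := by
    have : SemiconjBy (annih ψ - create ψ : Module.End ℂ (finiteParticle H))
      (Complex.I • squeezeMap ψ)
      (algebraMap ℂ (Module.End ℂ (finiteParticle H)) (-1) + Complex.I • squeezeMap ψ) :=
      field_mul_squeeze hψ
    exact congrArg (fun T : Module.End ℂ (finiteParticle H) => T x) (this.pow_right n).eq
  rw [← h3, ← Prod.smul_mk]
  exact Submodule.smul_mem _ _ (mem_closedGraph _)

/-- The same relation for all `t`, by dividing `t` into small steps. -/
theorem group_mem_closedGraph {ψ : H} (hψ : ‖ψ‖ = 1) (t : ℝ)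
    {p : Fock H × Fock H} (hp : p ∈ closedGraph (annih ψ - create ψ)) :
    (((isAnalyticSkew_squeeze hψ).group.toFun t : Fock H →L[ℂ] Fock H) p.1,
      Complex.exp (-t) • ((isAnalyticSkew_squeeze hψ).group.toFun t : Fock H →L[ℂ] Fock H) p.2) ∈
      closedGraph (annih ψ - create ψ) := by
  set E := (isAnalyticSkew_squeeze hψ).group with hE
  obtain ⟨m, hm⟩ := exists_nat_gt (|t| * 2)
  have hm0 : (0 : ℝ) < m := lt_of_le_of_lt (by positivity) hm
  have hs : |t / m| < 1 / 2 := by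
    rw [abs_div, Nat.abs_cast, div_lt_iff₀ hm0]
    linarith
  have key : ∀ k : ℕ, ((E.toFun (k * (t / m)) : Fock H →L[ℂ] Fock H) p.1,
      Complex.exp (-(k * (t / m) : ℝ)) •
        (E.toFun (k * (t / m)) : Fock H →L[ℂ] Fock H) p.2) ∈
      closedGraph (annih ψ - create ψ) := by
    intro k
    induction k with
    | zero => simpa [E.zero_apply] using hp
    | succ k ih =>
      have h1 := group_mem_closedGraph_of_lt hψ hs ih
      have e : ((k + 1 : ℕ) : ℝ) * (t / m) = t / m + k * (t / m) := by push_cast; ring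
      rw [e, E.add_apply, E.add_apply, Complex.ofReal_add, neg_add, Complex.exp_add, mul_smul]
      rwa [map_smul] at h1
  have := key m
  rwa [mul_div_cancel₀ t hm0.ne'] at this

theorem tensorLeft_smul (n : ℕ) (c : ℂ) (f : H) : tensorLeft n (c • f) = c • tensorLeft n f := by
  rw [tensorLeft, map_smul, ContinuousLinearMap.comp_smul]
  rfl

theorem createN_smul (n : ℕ) (c : ℂ) (f : H) : createN n (c • f) = c • createN n f := by
  refine ContinuousLinearMap.ext fun Φ => ?_
  rw [smul_apply, createN_apply, createN_apply, tensorLeft_smul,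
    smul_apply, map_smul, smul_comm]

/-- The field operator is linear in `f` for real scalars only, since `a(f)` is antilinear. -/
theorem annih_sub_create_smul (s : ℝ) (f : H) :
    annih ((s : ℂ) • f) - create ((s : ℂ) • f) = (s : ℂ) • (annih f - create f) := by
  rw [smul_sub]
  congr 1
  · refine LinearMap.ext fun x => Subtype.ext (lp.ext (funext fun n => ?_))
    rw [annih_apply, annihN, createN_smul, map_smulₛₗ, Complex.conj_ofReal]
    rfl
  · refine LinearMap.ext fun x => Subtype.ext (lp.ext (funext fun n => ?_))
    cases n with
    | zero =>
      rw [create_apply_zero]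
      exact (smul_zero (s : ℂ)).symm
    | succ n =>
      rw [create_apply_succ, createN_smul]
      rfl

theorem weyl_eq {f : H} {U : UnitaryGroup (Fock H)} (hU : IsGenerator U (fieldOp f).closure) :
    weyl f = (U.toFun 1 : Fock H →L[ℂ] Fock H) :=
  unitaryExp_eq (isAnalyticSkew_field f).existsUnique_isGenerator hU

theorem conj_weyl {ψ : H} (hψ : ‖ψ‖ = 1) (l : ℝ) :
    ((isAnalyticSkew_squeeze hψ).group.toFun l : Fock H →L[ℂ] Fock H) * weyl ψ *
        star ((isAnalyticSkew_squeeze hψ).group.toFun l : Fock H →L[ℂ] Fock H) =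
      weyl (((Real.exp l : ℝ) : ℂ) • ψ) := by
  set E := (isAnalyticSkew_squeeze hψ).group with hE
  have hW := isAnalyticSkew_field ψ
  have h1 := hW.isGenerator_of_hasDerivAt hW.hasDerivAt_group
  have h2 : IsGenerator (hW.group.conj E l) (fieldOp (((Real.exp l : ℝ) : ℂ) • ψ)).closure := by
    refine (isAnalyticSkew_field (((Real.exp l : ℝ) : ℂ) • ψ)).isGenerator_of_hasDerivAt fun x => ?_
    have h3 := group_mem_closedGraph hψ (-l) (mem_closedGraph (B := annih ψ - create ψ) x)
    rw [← hE, ← hW.hasDerivAt_iff hW.hasDerivAt_group] at h3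
    have h4 := ((E.toFun l : Fock H →L[ℂ] Fock H).restrictScalars ℝ).hasFDerivAt.comp_hasDerivAt
      0 h3
    have e : (((annih (((Real.exp l : ℝ) : ℂ) • ψ) - create (((Real.exp l : ℝ) : ℂ) • ψ)) x :
        finiteParticle H) : Fock H) =
        ((E.toFun l : Fock H →L[ℂ] Fock H).restrictScalars ℝ) (Complex.exp (-(-l : ℝ)) •
          (E.toFun (-l) : Fock H →L[ℂ] Fock H) ((annih ψ - create ψ) x : finiteParticle H)) := by
      rw [annih_sub_create_smul, ContinuousLinearMap.coe_restrictScalars', map_smul,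
        E.apply_neg_apply]
      push_cast
      rw [neg_neg]
      rfl
    rw [e]
    exact h4
  rw [weyl_eq h2, weyl_eq (f := ψ) h1, E.star_eq]
  rfl

end

end BoseFock

open BoseFock in
theorem lemma4p4p2 {H : Type*} [NormedAddCommGroup H] [InnerProductSpace ℂ H] [CompleteSpace H] :
    -- the closure of `a(φ) - a*(φ)` generates a unique unitary group, so that `W[φ]` is defined
    (∀ φ : H, (fieldOp φ).IsClosable ∧
      ∃! U : UnitaryGroup (Fock H), IsGenerator U (fieldOp φ).closure) ∧
    ∀ ψ : H, ‖ψ‖ = 1 →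
      -- the squeeze operator is essentially self-adjoint on the finite particle vectors
      IsEssentiallySelfAdjoint (squeeze ψ) ∧
      -- also on the span of the Fock basis vectors of any Hilbert basis `w` that contains `ψ`,
      -- which consists of analytic vectors
      (∀ (w : Set H) (b : HilbertBasis w ℂ H), (⇑b = fun x : w => (x : H)) → ψ ∈ w →
        IsEssentiallySelfAdjoint ((squeeze ψ).domRestrict (basisSpan w)) ∧
        ((squeeze ψ).domRestrict (basisSpan w)).closure = (squeeze ψ).closure ∧
        ∀ Φ ∈ basisSpan w, IsAnalyticVector ((squeeze ψ).domRestrict (basisSpan w)) (1 / 2) Φ) ∧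
      -- the unitary group `E l = exp (i l A)`, with `A` the closure of the squeeze operator
      ∃ E : UnitaryGroup (Fock H),
        IsGenerator E (Complex.I • (squeeze ψ).closure) ∧
        ∀ l : ℝ,
          (E.toFun l : Fock H →L[ℂ] Fock H) * weyl ψ * star (E.toFun l : Fock H →L[ℂ] Fock H) =
            weyl (((Real.exp l : ℝ) : ℂ) • ψ) := by
  refine ⟨fun φ => ⟨(isAnalyticSkew_field φ).isClosable,
    (isAnalyticSkew_field φ).existsUnique_isGenerator⟩, fun ψ hψ => ?_⟩
  have hS := isAnalyticSkew_squeeze hψ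
  refine ⟨hS.isEssentiallySelfAdjoint, fun w b hb hw => ?_,
    hS.group, hS.isGenerator_I_smul, conj_weyl hψ⟩
  have hd : Dense (Submodule.span ℂ w : Set H) := by
    have := b.dense_span
    rw [hb, Subtype.range_coe] at this
    exact (Submodule.dense_iff_topologicalClosure_eq_top).mpr this
  have hSw := isAnalyticSkew_squeezeBasis hd hw hψ
  rw [domRestrict_squeeze hw]
  exact ⟨hSw.isEssentiallySelfAdjoint,
    hS.closure_eq_of_restrict hSw fun x => ⟨Submodule.inclusion (basisSpan_le w) x, rfl, rfl⟩,
    fun Φ hΦ => hSw.isAnalyticVector hΦ⟩
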